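/- Let $\tilde{\mathbb C}$ be the split complex numbers ($i^2=1$) and $\tilde{\mathbb H}$ the split quaternions ($i^2=j^2=1$, $k=ij=-ji$). For a real composition algebra $K$ with quadratic form $|x|^2$ and conjugation $x\mapsto\bar x$, put $\langle x,y\rangle=\operatorname{Re}(x\bar y)$ and $K'=\{x:\langle x,1\rangle=0\}$; let $H_3(K)$ be the real vector space of hermitian $3\times3$ matrices over $K$ with the product $X\cdot Y=XY+YX$, whose unit is $e=\tfrac12 1$ ($1$ the identity matrix), and let $H_3'(K)$ be the subspace of traceless matrices. Write $L_a$, $R_a$ for left and right multiplications and $\operatorname{Der}$ for derivation algebras. For $K_1\in\{\mathbb R,\mathbb C,\mathbb H,\mathbb O\}$ and $K_2\in\{\mathbb R,\tilde{\mathbb C},\tilde{\mathbb H}\}$ let $$L_3(K_1,K_2)=\operatorname{Der}H_3(K_1)\,\dot+\,H_3'(K_1)\otimes K_2'\,\dot+\,\operatorname{Der}K_2$$ with the bracket that extends the commutators of $\operatorname{Der}H_3(K_1)$ and of $\operatorname{Der}K_2$ and satisfies $[D,E]=0$, $[D,A\otimes x]=D(A)\otimes x$, $[E,A\otimes x]=A\otimes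 E(x)$ and $$[A\otimes x,B\otimes y]=\tfrac16\langle A,B\rangle D_{x,y}+(A*B)\otimes\tfrac12[x,y]-\langle x,y\rangle[L_A,L_B],$$ where $\langle A,B\rangle=\operatorname{Re}\operatorname{tr}(A\cdot B)$, $A*B=A\cdot B-\tfrac13\operatorname{tr}(A\cdot B)1$ and $D_{x,y}=[L_x,L_y]+[L_x,R_y]+[R_x,R_y]$. For the Jordan algebra $J=H_3(K)$ let $\operatorname{Str}J$ be the Lie algebra generated by all multiplications $L_a$ (it equals $\operatorname{Der}J\,\dot+\,L(J)$), let $\operatorname{Str}'J$ be its quotient by its centre, and let $\operatorname{Con}J=\operatorname{Str}J\,\dot+\,J^2$ be the Kantor–Koecher conformal algebra, in which $\operatorname{Str}J$ is a subalgebra and $$[T,(X,Y)]=(TX,T^*Y),\quad [(X,0),(X',0)]=[(0,Y),(0,Y')]=0,\quad [(X,0),(0,Y)]=2L_{X\cdot Y}+2[L_X,L_Y],$$ where $T\mapsto T^*$ is the identity on $\operatorname{Der}J$ and $L_a^*=-L_a$. Theorem. Let $K$ be $\mathbb R$, $\mathbb C$, $\mathbb H$ or $\mathbb O$. The brackets above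 are well defined on $L_3(K,\mathbb R)$, $L_3(K,\tilde{\mathbb C})$, $L_3(K,\tilde{\mathbb H})$ and $\operatorname{Con}H_3(K)$ and make them Lie algebras, and there are Lie algebra isomorphisms $$\varphi_2:L_3(K,\mathbb R)\cong\operatorname{Der}H_3(K),\qquad \varphi_1:L_3(K,\tilde{\mathbb C})\cong\operatorname{Str}'H_3(K),\qquad \varphi:L_3(K,\tilde{\mathbb H})\cong\operatorname{Con}H_3(K).$$ Moreover $\varphi$ can be chosen such that, for $D\in\operatorname{Der}H_3(K)$, $B\in H_3'(K)$ and with $C_a(q)=aq-qa$, $$\varphi(D)=D,\quad \varphi(B\otimes i)=L_B,\quad \varphi(B\otimes j)=\tfrac12(B,B),\quad \varphi(B\otimes k)=\tfrac12(B,-B),$$ $$\varphi(C_i)=2\,\mathrm{id},\quad \varphi(C_j)=(e,e),\quad \varphi(C_k)=(e,-e),$$ and $\varphi_1,\varphi_2$ are given by restricting it: $\varphi_1(D)$ and $\varphi_1(B\otimes i)$ are the classes of $D$ and $L_B$ in $\operatorname{Str}'H_3(K)$, and $\varphi_2(D)=D$. -/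

import Mathlib

open scoped TensorProduct Quaternion QuadraticAlgebra

attribute [local instance] LieRing.ofAssociativeRing

noncomputable section

/-! ### Composition algebras -/

/-- A real composition algebra: a unital, not necessarily associative real algebra with a
nondegenerate quadratic form `|x|² = form x x` such that `|xy|² = |x|²|y|²`. Here
`form x y = ½(|x + y|² - |x|² - |y|²)` is the associated symmetric bilinear form, `form x 1` is
the real part of `x`, and the conjugation `star` fixes the real scalars and is `-1` on their
orthogonal complement. -/
class CompositionAlgebra (K : Type*) [NonAssocRing K] [StarRing K] [Module ℝ K] where
  form : K →ₗ[ℝ] K →ₗ[ℝ] ℝ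
  form_symm : ∀ x y, form x y = form y x
  form_nondeg : ∀ x, (∀ y, form x y = 0) → x = 0
  form_mul : ∀ x y, form (x * y) (x * y) = form x x * form y y
  star_eq : ∀ x, star x = (2 * form x 1) • (1 : K) - x

open CompositionAlgebra (form)

instance : CompositionAlgebra ℝ where
  form := LinearMap.mul ℝ ℝ
  form_symm x y := by simp [mul_comm]
  form_nondeg x h := by simpa using h 1
  form_mul x y := by simp; ring
  star_eq x := by simp; ring

instance : CompositionAlgebra ℂ where
  form := LinearMap.mk₂ ℝ (fun x y : ℂ => x.re * y.re + x.im * y.im)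
    (by intros; simp; ring) (by intros; simp; ring) (by intros; simp; ring)
    (by intros; simp; ring)
  form_symm x y := by simp [mul_comm]
  form_nondeg x h := by
    have h1 := h 1
    have h2 := h Complex.I
    apply Complex.ext <;> simp_all
  form_mul x y := by simp; ring
  star_eq x := by apply Complex.ext <;> simp; ring

instance : CompositionAlgebra ℍ[ℝ] where
  form := LinearMap.mk₂ ℝ (fun x y : ℍ[ℝ] =>
      x.re * y.re + x.imI * y.imI + x.imJ * y.imJ + x.imK * y.imK)
    (by intros; simp; ring) (by intros; simp; ring) (by intros; simp; ring)
    (by intros; simp; ring)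
  form_symm x y := by simp [mul_comm]
  form_nondeg x h := by
    have h1 : x.re * 1 + x.imI * 0 + x.imJ * 0 + x.imK * 0 = 0 :=
      h ⟨1, 0, 0, 0⟩
    have h2 : x.re * 0 + x.imI * 1 + x.imJ * 0 + x.imK * 0 = 0 :=
      h ⟨0, 1, 0, 0⟩
    have h3 : x.re * 0 + x.imI * 0 + x.imJ * 1 + x.imK * 0 = 0 :=
      h ⟨0, 0, 1, 0⟩
    have h4 : x.re * 0 + x.imI * 0 + x.imJ * 0 + x.imK * 1 = 0 :=
      h ⟨0, 0, 0, 1⟩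
    apply QuaternionAlgebra.ext
    · change x.re = 0; linarith
    · change x.imI = 0; linarith
    · change x.imJ = 0; linarith
    · change x.imK = 0; linarith
  form_mul x y := by simp; ring
  star_eq x := by ext <;> simp; ring

/-- The octonions, by the Cayley–Dickson doubling of the quaternions. -/
@[ext] structure Octonion where
  fst : ℍ[ℝ]
  snd : ℍ[ℝ]

namespace Octonion

instance : Zero Octonion := ⟨⟨0, 0⟩⟩
instance : One Octonion := ⟨⟨1, 0⟩⟩
instance : Add Octonion := ⟨fun x y => ⟨x.fst + y.fst, x.snd + y.snd⟩⟩
instance : Neg Octonion := ⟨fun x => ⟨-x.fst, -x.snd⟩⟩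
instance : Sub Octonion := ⟨fun x y => ⟨x.fst - y.fst, x.snd - y.snd⟩⟩
instance : Mul Octonion :=
  ⟨fun x y => ⟨x.fst * y.fst - star y.snd * x.snd, y.snd * x.fst + x.snd * star y.fst⟩⟩
instance : SMul ℝ Octonion := ⟨fun r x => ⟨r • x.fst, r • x.snd⟩⟩
instance : Star Octonion := ⟨fun x => ⟨star x.fst, -x.snd⟩⟩

@[simp] theorem zero_fst : (0 : Octonion).fst = 0 := rfl
@[simp] theorem zero_snd : (0 : Octonion).snd = 0 := rfl
@[simp] theorem one_fst : (1 : Octonion).fst = 1 := rfl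
@[simp] theorem one_snd : (1 : Octonion).snd = 0 := rfl
@[simp] theorem add_fst (x y : Octonion) : (x + y).fst = x.fst + y.fst := rfl
@[simp] theorem add_snd (x y : Octonion) : (x + y).snd = x.snd + y.snd := rfl
@[simp] theorem neg_fst (x : Octonion) : (-x).fst = -x.fst := rfl
@[simp] theorem neg_snd (x : Octonion) : (-x).snd = -x.snd := rfl
@[simp] theorem sub_fst (x y : Octonion) : (x - y).fst = x.fst - y.fst := rfl
@[simp] theorem sub_snd (x y : Octonion) : (x - y).snd = x.snd - y.snd := rfl
@[simp] theorem smul_fst (r : ℝ) (x : Octonion) : (r • x).fst = r • x.fst := rfl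
@[simp] theorem smul_snd (r : ℝ) (x : Octonion) : (r • x).snd = r • x.snd := rfl
@[simp] theorem star_fst (x : Octonion) : (star x).fst = star x.fst := rfl
@[simp] theorem star_snd (x : Octonion) : (star x).snd = -x.snd := rfl
@[simp] theorem mul_fst (x y : Octonion) :
    (x * y).fst = x.fst * y.fst - star y.snd * x.snd := rfl
@[simp] theorem mul_snd (x y : Octonion) :
    (x * y).snd = y.snd * x.fst + x.snd * star y.fst := rfl

instance : NonAssocRing Octonion where
  add_assoc _ _ _ := by ext1 <;> simp [add_assoc]
  zero_add _ := by ext1 <;> simp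
  add_zero _ := by ext1 <;> simp
  add_comm _ _ := by ext1 <;> simp [add_comm]
  neg_add_cancel _ := by ext1 <;> simp
  sub_eq_add_neg _ _ := by ext1 <;> simp [sub_eq_add_neg]
  nsmul := nsmulRec
  zsmul := zsmulRec
  left_distrib _ _ _ := by ext1 <;> simp [mul_add, add_mul] <;> abel
  right_distrib _ _ _ := by ext1 <;> simp [mul_add, add_mul] <;> abel
  zero_mul _ := by ext1 <;> simp
  mul_zero _ := by ext1 <;> simp
  one_mul _ := by ext1 <;> simp
  mul_one _ := by ext1 <;> simp

instance : Module ℝ Octonion where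
  one_smul _ := by ext1 <;> simp
  mul_smul _ _ _ := by ext1 <;> simp [mul_smul]
  smul_zero _ := by ext1 <;> simp
  smul_add _ _ _ := by ext1 <;> simp
  add_smul _ _ _ := by ext1 <;> simp [add_smul]
  zero_smul _ := by ext1 <;> simp

instance : StarRing Octonion where
  star_involutive _ := by ext1 <;> simp
  star_mul _ _ := by ext1 <;> simp [sub_eq_add_neg]
  star_add _ _ := by ext1 <;> simp [add_comm]

instance : IsScalarTower ℝ Octonion Octonion :=
  ⟨fun _ _ _ => by ext1 <;> simp [smul_sub]⟩

instance : SMulCommClass ℝ Octonion Octonion :=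
  ⟨fun _ _ _ => by ext1 <;> simp [smul_sub]⟩

instance : CompositionAlgebra Octonion where
  form := LinearMap.mk₂ ℝ (fun x y : Octonion => form x.fst y.fst + form x.snd y.snd)
    (by intros; simp; ring) (by intros; simp; ring) (by intros; simp; ring)
    (by intros; simp; ring)
  form_symm x y := by
    simp [CompositionAlgebra.form_symm x.fst, CompositionAlgebra.form_symm x.snd]
  form_nondeg x h := by
    ext1
    · exact CompositionAlgebra.form_nondeg _ fun y => by simpa using h ⟨y, 0⟩
    · exact CompositionAlgebra.form_nondeg _ fun y => by simpa using h ⟨0, y⟩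
  form_mul x y := by
    simp [form]
    ring
  star_eq x := by
    ext1
    · simp [CompositionAlgebra.star_eq x.fst]
    · simp

end Octonion

/-- The split complex numbers, `i² = 1`. -/
abbrev SplitComplex : Type := QuadraticAlgebra ℝ 1 0

/-- The split quaternions, `i² = j² = 1`, `k = ij = -ji`, `k² = -1`. -/
abbrev SplitQuaternion : Type := ℍ[ℝ,1,0,1]

instance : CompositionAlgebra SplitComplex where
  form := LinearMap.mk₂ ℝ (fun x y : SplitComplex => x.re * y.re - x.im * y.im)
    (by intros; simp; ring) (by intros; simp; ring) (by intros; simp; ring)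
    (by intros; simp; ring)
  form_symm x y := by simp [mul_comm]
  form_nondeg x h := by
    have h1 := h ⟨1, 0⟩
    have h2 := h ⟨0, 1⟩
    ext <;> simp_all
  form_mul x y := by simp; ring
  star_eq x := by ext <;> simp; ring

instance : CompositionAlgebra SplitQuaternion where
  form := LinearMap.mk₂ ℝ (fun x y : SplitQuaternion =>
      x.re * y.re - x.imI * y.imI - x.imJ * y.imJ + x.imK * y.imK)
    (by intros; simp; ring) (by intros; simp; ring) (by intros; simp; ring)
    (by intros; simp; ring)
  form_symm x y := by simp [mul_comm]
  form_nondeg x h := by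
    have h1 : x.re * 1 - x.imI * 0 - x.imJ * 0 + x.imK * 0 = 0 :=
      h ⟨1, 0, 0, 0⟩
    have h2 : x.re * 0 - x.imI * 1 - x.imJ * 0 + x.imK * 0 = 0 :=
      h ⟨0, 1, 0, 0⟩
    have h3 : x.re * 0 - x.imI * 0 - x.imJ * 1 + x.imK * 0 = 0 :=
      h ⟨0, 0, 1, 0⟩
    have h4 : x.re * 0 - x.imI * 0 - x.imJ * 0 + x.imK * 1 = 0 :=
      h ⟨0, 0, 0, 1⟩
    apply QuaternionAlgebra.ext
    · change x.re = 0; linarith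
    · change x.imI = 0; linarith
    · change x.imJ = 0; linarith
    · change x.imK = 0; linarith
  form_mul x y := by simp; ring
  star_eq x := by ext <;> simp; ring

/-- The composition algebra `K` is one of `ℝ`, `ℂ`, `ℍ`, `𝕆`. -/
inductive IsRCHO : (K : Type) → [NonAssocRing K] → [StarRing K] → [Module ℝ K] →
    [IsScalarTower ℝ K K] → [SMulCommClass ℝ K K] → [CompositionAlgebra K] → Prop
  | real : IsRCHO ℝ
  | complex : IsRCHO ℂ
  | quaternion : IsRCHO ℍ[ℝ]
  | octonion : IsRCHO Octonion

/-! ### Derivation, structure and conformal algebras -/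

section Algebras

variable {V : Type*} [AddCommGroup V] [Module ℝ V]

/-- The derivation algebra of the real algebra with underlying space `V` and product `m`. -/
def Der (m : V →ₗ[ℝ] V →ₗ[ℝ] V) : LieSubalgebra ℝ (Module.End ℝ V) where
  carrier := {D | ∀ x y, D (m x y) = m (D x) y + m x (D y)}
  zero_mem' := by intro x y; simp
  add_mem' := by
    intro D E hD hE x y
    simp only [LinearMap.add_apply, hD x y, hE x y, map_add]
    abel
  smul_mem' := by
    intro r D hD x y
    simp only [LinearMap.smul_apply, hD x y, map_smul, smul_add]
  lie_mem' := by
    intro D E hD hE x y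
    simp only [LieRing.of_associative_ring_bracket, LinearMap.sub_apply, Module.End.mul_apply,
      hD _ _, hE _ _, map_add, map_sub]
    abel

/-- The structure algebra: the Lie algebra generated by all left and right multiplications. -/
def Str (m : V →ₗ[ℝ] V →ₗ[ℝ] V) : LieSubalgebra ℝ (Module.End ℝ V) :=
  LieSubalgebra.lieSpan ℝ (Module.End ℝ V) {T | ∃ a, T = m a ∨ T = m.flip a}

/-- The reduced structure algebra: the structure algebra modulo its centre. -/
abbrev StrPrime (m : V →ₗ[ℝ] V →ₗ[ℝ] V) : Type _ := Str m ⧸ LieAlgebra.center ℝ (Str m)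

/-- The multiplication `L_a`, as an element of the structure algebra. -/
def Str.mulLeft (m : V →ₗ[ℝ] V →ₗ[ℝ] V) : V →ₗ[ℝ] Str m where
  toFun a := ⟨m a, LieSubalgebra.subset_lieSpan ⟨a, Or.inl rfl⟩⟩
  map_add' a b := by ext; simp
  map_smul' r a := by ext; simp

/-- For a Jordan algebra with product `m` and unit `e`, for which the structure algebra is
`Der + {L_a}`, this is the map `T ↦ T*` that is the identity on derivations and sends `L_a` to
`-L_a`: if `T = D + L_a` with a derivation `D`, then `T e = a`. -/
def Str.dagger (m : V →ₗ[ℝ] V →ₗ[ℝ] V) (e : V) : Str m →ₗ[ℝ] Str m where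
  toFun T := T - (2 : ℝ) • Str.mulLeft m ((T : Module.End ℝ V) e)
  map_add' S T := by
    have h : ((S + T : Str m) : Module.End ℝ V) e
      = (S : Module.End ℝ V) e + (T : Module.End ℝ V) e := rfl
    rw [h, map_add, smul_add]
    abel
  map_smul' r T := by
    have h : ((r • T : Str m) : Module.End ℝ V) e = r • (T : Module.End ℝ V) e := rfl
    rw [h, map_smul, RingHom.id_apply, smul_sub, smul_comm r (2 : ℝ)]

theorem Str.dagger_mulLeft (m : V →ₗ[ℝ] V →ₗ[ℝ] V) (e : V) (he : ∀ a, m a e = a) (a : V) :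
    Str.dagger m e (Str.mulLeft m a) = -Str.mulLeft m a := by
  simp only [Str.dagger, LinearMap.coe_mk, AddHom.coe_mk]
  have : ((Str.mulLeft m a : Str m) : Module.End ℝ V) e = a := he a
  rw [this, two_smul]
  abel

theorem Str.dagger_of_mem_der (m : V →ₗ[ℝ] V →ₗ[ℝ] V) (e : V) (he : ∀ a, m a e = a)
    (he' : ∀ a, m e a = a) (T : Str m) (hT : (T : Module.End ℝ V) ∈ Der m) :
    Str.dagger m e T = T := by
  have h : (T : Module.End ℝ V) (m e e) =
    m ((T : Module.End ℝ V) e) e + m e ((T : Module.End ℝ V) e) := hT e e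
  rw [he, he, he', left_eq_add] at h
  simp [Str.dagger, h]

/-- The underlying space of the conformal algebra, `Str ∔ V²`. -/
abbrev ConAlg (m : V →ₗ[ℝ] V →ₗ[ℝ] V) : Type _ := Str m × V × V

/-- `[(X,0),(0,Y)] = 2 L_{XY} + 2 [L_X, L_Y]`. -/
def ConAlg.box (m : V →ₗ[ℝ] V →ₗ[ℝ] V) : V →ₗ[ℝ] V →ₗ[ℝ] Str m :=
  LinearMap.mk₂ ℝ (fun X Y =>
      (2 : ℝ) • Str.mulLeft m (m X Y) + (2 : ℝ) • ⁅Str.mulLeft m X, Str.mulLeft m Y⁆)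
    (by intros; simp; abel) (by intro c; intros; simp [smul_comm c (2 : ℝ)]) (by intros; simp; abel)
    (by intro c; intros; simp [smul_comm c (2 : ℝ)])

/-- The Kantor–Koecher bracket on the conformal algebra of the Jordan algebra with product `m` and
unit `e`: the structure algebra is a subalgebra, `[T,(X,Y)] = (T X, T* Y)`,
`[(X,0),(X',0)] = [(0,Y),(0,Y')] = 0` and `[(X,0),(0,Y)] = 2 L_{XY} + 2 [L_X, L_Y]`. -/
def conBracket (m : V →ₗ[ℝ] V →ₗ[ℝ] V) (e : V) : ConAlg m →ₗ[ℝ] ConAlg m →ₗ[ℝ] ConAlg m :=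
  LinearMap.mk₂ ℝ (fun u v =>
      (⁅u.1, v.1⁆ + ConAlg.box m u.2.1 v.2.2 - ConAlg.box m v.2.1 u.2.2,
        (u.1 : Module.End ℝ V) v.2.1 - (v.1 : Module.End ℝ V) u.2.1,
        (Str.dagger m e u.1 : Module.End ℝ V) v.2.2
          - (Str.dagger m e v.1 : Module.End ℝ V) u.2.2))
    (by intros; ext1; · simp; abel
        ext1 <;> simp <;> abel)
    (by intros; ext1; · simp [smul_sub]
        ext1 <;> simp [smul_sub])
    (by intros; ext1; · simp; abel
        ext1 <;> simp <;> abel)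
    (by intros; ext1; · simp [smul_sub]
        ext1 <;> simp [smul_sub])

/-- The bilinear bracket `b` makes the subspace `S` a Lie algebra. -/
structure IsLieOn (b : V →ₗ[ℝ] V →ₗ[ℝ] V) (S : Submodule ℝ V) : Prop where
  closed : ∀ u ∈ S, ∀ v ∈ S, b u v ∈ S
  self : ∀ u ∈ S, b u u = 0
  jacobi : ∀ u ∈ S, ∀ v ∈ S, ∀ w ∈ S, b u (b v w) + b v (b w u) + b w (b u v) = 0

end Algebras

/-! ### Hermitian `3 × 3` matrices -/

section Hermitian

variable (K : Type*) [NonAssocRing K] [StarRing K] [Module ℝ K] [CompositionAlgebra K]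

/-- The subspace of hermitian matrices among the `3 × 3` matrices over `K`. -/
def hermitian : Submodule ℝ (Matrix (Fin 3) (Fin 3) K) where
  carrier := {X | X.conjTranspose = X}
  zero_mem' := Matrix.conjTranspose_zero
  add_mem' := by
    intro X Y hX hY
    change Matrix.conjTranspose _ = _ at hX hY ⊢
    rw [Matrix.conjTranspose_add, hX, hY]
  smul_mem' := by
    intro r X hX
    have hs : ∀ x : K, star (r • x) = r • star x := fun x => by
      simp only [CompositionAlgebra.star_eq, map_smul, LinearMap.smul_apply, smul_eq_mul, smul_sub,
        smul_smul]
      congr 2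
      ring
    change Matrix.conjTranspose _ = _ at hX ⊢
    conv_rhs => rw [← hX]
    ext i j
    simp [hs]

/-- `H₃(K)`, the real vector space of hermitian `3 × 3` matrices over `K`. -/
def H3 : Type _ := hermitian K

instance : AddCommGroup (H3 K) := inferInstanceAs (AddCommGroup (hermitian K))

instance : Module ℝ (H3 K) := inferInstanceAs (Module ℝ (hermitian K))

variable {K} in
/-- The matrix underlying an element of `H₃(K)`. -/
def H3.mat : H3 K →ₗ[ℝ] Matrix (Fin 3) (Fin 3) K := (hermitian K).subtype

variable {K} in
theorem H3.mat_injective : Function.Injective (H3.mat (K := K)) := Subtype.val_injective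

/-- `K'`, the subspace of `K` orthogonal to `ℝ`. -/
def Imag : Submodule ℝ K := LinearMap.ker ((form (K := K)).flip 1)

/-- `H₃'(K)`, the traceless hermitian matrices. -/
def H3' : Submodule ℝ (H3 K) :=
  LinearMap.ker (Matrix.traceLinearMap (Fin 3) ℝ K ∘ₗ H3.mat)

/-- The real linear form `Re tr` on `H₃(K)`; the trace of a hermitian matrix is real. -/
def reTrace : H3 K →ₗ[ℝ] ℝ :=
  (form (K := K)).flip 1 ∘ₗ Matrix.traceLinearMap (Fin 3) ℝ K ∘ₗ H3.mat

/-- The identity matrix, as a hermitian matrix. -/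
def H3.idMatrix : H3 K := ⟨1, Matrix.conjTranspose_one⟩

/-- The unit of the Jordan algebra `H₃(K)` with product `XY + YX`: half the identity matrix. -/
def H3.unit : H3 K := (1 / 2 : ℝ) • H3.idMatrix K

theorem H3.mat_unit : H3.mat (H3.unit K) = (1 / 2 : ℝ) • (1 : Matrix (Fin 3) (Fin 3) K) := rfl

/-- The hermitian matrix `XY + YX`. -/
def jprod (X Y : H3 K) : H3 K :=
  ⟨H3.mat X * H3.mat Y + H3.mat Y * H3.mat X, by
    have hX : (H3.mat X).conjTranspose = H3.mat X := X.2
    have hY : (H3.mat Y).conjTranspose = H3.mat Y := Y.2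
    change Matrix.conjTranspose _ = _
    rw [Matrix.conjTranspose_add, Matrix.conjTranspose_mul, Matrix.conjTranspose_mul, hX, hY,
      add_comm]⟩

theorem mat_jprod (X Y : H3 K) :
    H3.mat (jprod K X Y) = H3.mat X * H3.mat Y + H3.mat Y * H3.mat X := rfl

variable [IsScalarTower ℝ K K] [SMulCommClass ℝ K K]

/-- The Jordan product `X · Y = XY + YX` on `H₃(K)`. -/
def jmul : H3 K →ₗ[ℝ] H3 K →ₗ[ℝ] H3 K :=
  LinearMap.mk₂ ℝ (jprod K)
    (by
      intros
      apply H3.mat_injective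
      simp only [map_add, mat_jprod, Matrix.add_mul, Matrix.mul_add]
      abel)
    (by
      intros
      apply H3.mat_injective
      simp only [map_smul, mat_jprod, Matrix.smul_mul, Matrix.mul_smul, smul_add])
    (by
      intros
      apply H3.mat_injective
      simp only [map_add, mat_jprod, Matrix.add_mul, Matrix.mul_add]
      abel)
    (by
      intros
      apply H3.mat_injective
      simp only [map_smul, mat_jprod, Matrix.smul_mul, Matrix.mul_smul, smul_add])

theorem H3.mat_jmul (X Y : H3 K) :
    H3.mat (jmul K X Y) = H3.mat X * H3.mat Y + H3.mat Y * H3.mat X := rfl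

theorem jmul_unit (X : H3 K) : jmul K X (H3.unit K) = X := by
  apply H3.mat_injective
  rw [H3.mat_jmul, H3.mat_unit, Matrix.mul_smul, Matrix.smul_mul, Matrix.mul_one, Matrix.one_mul,
    ← add_smul]
  norm_num

theorem unit_jmul (X : H3 K) : jmul K (H3.unit K) X = X := by
  apply H3.mat_injective
  rw [H3.mat_jmul, H3.mat_unit, Matrix.mul_smul, Matrix.smul_mul, Matrix.mul_one, Matrix.one_mul,
    ← add_smul]
  norm_num

/-- `⟨A, B⟩ = Re tr (A · B)`. -/
def trForm : H3 K →ₗ[ℝ] H3 K →ₗ[ℝ] ℝ := (jmul K).compr₂ (reTrace K)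

/-- `A ∗ B = A · B - ⅓ tr (A · B)`, the traceless part of the Jordan product. -/
def ast : H3 K →ₗ[ℝ] H3 K →ₗ[ℝ] H3 K :=
  jmul K - (trForm K).compr₂ (LinearMap.toSpanSingleton ℝ (H3 K) ((1 / 3 : ℝ) • H3.idMatrix K))

/-- `(A, B) ↦ [L_A, L_B]`. -/
def commMul : H3 K →ₗ[ℝ] H3 K →ₗ[ℝ] Module.End ℝ (H3 K) :=
  LinearMap.mk₂ ℝ (fun A B => ⁅(jmul K A : Module.End ℝ (H3 K)), jmul K B⁆)
    (by intros; simp) (by intros; simp) (by intros; simp) (by intros; simp)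

/-- `½[x, y] = ½(xy - yx)`. -/
def halfComm : K →ₗ[ℝ] K →ₗ[ℝ] K :=
  (1 / 2 : ℝ) • (LinearMap.mul ℝ K - (LinearMap.mul ℝ K).flip)

/-- `D_{x,y} = [L_x, L_y] + [L_x, R_y] + [R_x, R_y]`. -/
def derMap : K →ₗ[ℝ] K →ₗ[ℝ] Module.End ℝ K :=
  LinearMap.mk₂ ℝ (fun x y =>
      ⁅(LinearMap.mulLeft ℝ x : Module.End ℝ K), LinearMap.mulLeft ℝ y⁆
        + ⁅(LinearMap.mulLeft ℝ x : Module.End ℝ K), LinearMap.mulRight ℝ y⁆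
        + ⁅(LinearMap.mulRight ℝ x : Module.End ℝ K), LinearMap.mulRight ℝ y⁆)
    (by intros; ext; simp [Ring.lie_def, add_mul, mul_add]; abel)
    (by intros; ext; simp [Ring.lie_def, smul_add, smul_sub, smul_mul_assoc, mul_smul_comm])
    (by intros; ext; simp [Ring.lie_def, add_mul, mul_add]; abel)
    (by intros; ext; simp [Ring.lie_def, smul_add, smul_sub, smul_mul_assoc, mul_smul_comm])

end Hermitian

/-! ### The Tits construction -/

section Tits

variable (K₁ K₂ : Type*)
  [NonAssocRing K₁] [StarRing K₁] [Module ℝ K₁] [CompositionAlgebra K₁]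
  [IsScalarTower ℝ K₁ K₁] [SMulCommClass ℝ K₁ K₁]
  [NonAssocRing K₂] [StarRing K₂] [Module ℝ K₂] [CompositionAlgebra K₂]
  [IsScalarTower ℝ K₂ K₂] [SMulCommClass ℝ K₂ K₂]

/-- An ambient space for `L₃(K₁, K₂)`, on which all terms of the bracket make sense. -/
abbrev TitsSpace : Type _ := Module.End ℝ (H3 K₁) × (H3 K₁ ⊗[ℝ] K₂) × Module.End ℝ K₂

/-- The vector space `L₃(K₁, K₂) = Der H₃(K₁) ∔ H₃'(K₁) ⊗ K₂' ∔ Der K₂`. -/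
def L3 : Submodule ℝ (TitsSpace K₁ K₂) :=
  (Der (jmul K₁)).toSubmodule.prod
    ((Submodule.map₂ (TensorProduct.mk ℝ (H3 K₁) K₂) (H3' K₁) (Imag K₂)).prod
      (Der (LinearMap.mul ℝ K₂)).toSubmodule)

/-- The bilinear extension of `(A ⊗ x, B ⊗ y) ↦ -⟨x, y⟩ [L_A, L_B]`. -/
def titsPart₁ : H3 K₁ ⊗[ℝ] K₂ →ₗ[ℝ] H3 K₁ ⊗[ℝ] K₂ →ₗ[ℝ] Module.End ℝ (H3 K₁) :=
  (TensorProduct.map₂ (commMul K₁) (-form (K := K₂))).compr₂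
    (TensorProduct.rid ℝ (Module.End ℝ (H3 K₁))).toLinearMap

/-- The bilinear extension of `(A ⊗ x, B ⊗ y) ↦ (A ∗ B) ⊗ ½[x, y]`. -/
def titsPart₂ : H3 K₁ ⊗[ℝ] K₂ →ₗ[ℝ] H3 K₁ ⊗[ℝ] K₂ →ₗ[ℝ] H3 K₁ ⊗[ℝ] K₂ :=
  TensorProduct.map₂ (ast K₁) (halfComm K₂)

/-- The bilinear extension of `(A ⊗ x, B ⊗ y) ↦ ⅙ ⟨A, B⟩ D_{x,y}`. -/
def titsPart₃ : H3 K₁ ⊗[ℝ] K₂ →ₗ[ℝ] H3 K₁ ⊗[ℝ] K₂ →ₗ[ℝ] Module.End ℝ K₂ :=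
  (TensorProduct.map₂ ((1 / 6 : ℝ) • trForm K₁) (derMap K₂)).compr₂
    (TensorProduct.lid ℝ (Module.End ℝ K₂)).toLinearMap

/-- The bracket of Tits: `Der H₃(K₁)` and `Der K₂` carry their commutators and commute with each
other, `[D, A ⊗ x] = D(A) ⊗ x`, `[E, A ⊗ x] = A ⊗ E(x)` and
`[A ⊗ x, B ⊗ y] = ⅙⟨A, B⟩ D_{x,y} + (A ∗ B) ⊗ ½[x, y] - ⟨x, y⟩ [L_A, L_B]`. -/
def titsBracket : TitsSpace K₁ K₂ →ₗ[ℝ] TitsSpace K₁ K₂ →ₗ[ℝ] TitsSpace K₁ K₂ :=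
  LinearMap.mk₂ ℝ (fun u v =>
      (⁅u.1, v.1⁆ + titsPart₁ K₁ K₂ u.2.1 v.2.1,
        u.1.rTensor K₂ v.2.1 - v.1.rTensor K₂ u.2.1
          + (u.2.2.lTensor (H3 K₁) v.2.1 - v.2.2.lTensor (H3 K₁) u.2.1)
          + titsPart₂ K₁ K₂ u.2.1 v.2.1,
        ⁅u.2.2, v.2.2⁆ + titsPart₃ K₁ K₂ u.2.1 v.2.1))
    (by intros; ext1; · simp; abel
        ext1 <;> simp [LinearMap.rTensor_add, LinearMap.lTensor_add] <;> abel)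
    (by intros; ext1; · simp
        ext1 <;> simp [LinearMap.rTensor_smul, LinearMap.lTensor_smul, smul_sub])
    (by intros; ext1; · simp; abel
        ext1 <;> simp [LinearMap.rTensor_add, LinearMap.lTensor_add] <;> abel)
    (by intros; ext1; · simp
        ext1 <;> simp [LinearMap.rTensor_smul, LinearMap.lTensor_smul, smul_sub])

variable {K₁ K₂}

/-- A derivation of `H₃(K₁)`, as an element of `L₃(K₁, K₂)`. -/
def L3.ofDer (D : Der (jmul K₁)) : L3 K₁ K₂ :=
  ⟨(D, 0, 0), D.2, Submodule.zero_mem _, Submodule.zero_mem _⟩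

/-- `A ⊗ x`, as an element of `L₃(K₁, K₂)`. -/
def L3.tmul (A : H3' K₁) (x : Imag K₂) : L3 K₁ K₂ :=
  ⟨(0, (A : H3 K₁) ⊗ₜ[ℝ] (x : K₂), 0), Submodule.zero_mem _,
    Submodule.apply_mem_map₂ _ A.2 x.2, Submodule.zero_mem _⟩

/-- A derivation of `K₂`, as an element of `L₃(K₁, K₂)`. -/
def L3.ofDer₂ (E : Der (LinearMap.mul ℝ K₂)) : L3 K₁ K₂ :=
  ⟨(0, 0, E), Submodule.zero_mem _, Submodule.zero_mem _, E.2⟩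

end Tits

/-! ### Elements of the split algebras -/

/-- The element `i` of the split complex numbers. -/
def SplitComplex.i : Imag SplitComplex :=
  ⟨⟨0, 1⟩, by simp [Imag, form]⟩

namespace SplitQuaternion

/-- The element `i`. -/
def i : Imag SplitQuaternion := ⟨⟨0, 1, 0, 0⟩, by simp [Imag, form]⟩

/-- The element `j`. -/
def j : Imag SplitQuaternion := ⟨⟨0, 0, 1, 0⟩, by simp [Imag, form]⟩

/-- The element `k = ij`. -/
def k : Imag SplitQuaternion := ⟨⟨0, 0, 0, 1⟩, by simp [Imag, form]⟩

/-- The derivation `C_a : q ↦ aq - qa`. -/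
def C (a : SplitQuaternion) : Der (LinearMap.mul ℝ SplitQuaternion) :=
  ⟨LinearMap.mulLeft ℝ a - LinearMap.mulRight ℝ a, by
    intro x y
    simp only [LinearMap.mul_apply', LinearMap.sub_apply, LinearMap.mulLeft_apply,
      LinearMap.mulRight_apply]
    noncomm_ring⟩

end SplitQuaternion

end

set_option linter.unusedSectionVars false

/-! Every derivation of the split quaternions is `C_q` with `q` imaginary, so an element of `L₃(K,
ℍ̃)` is `D + A⊗i + B⊗j + C⊗k + C_q` with `q = ai + bj + ck` and `A, B, C` traceless. Since `H₃(K) =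
H₃'(K) ⊕ ℝe`, the pair `(A, a)` amounts to one hermitian matrix `A + 2ae`, and likewise for `(B, b)`
and `(C, c)`. The first matrix gives a multiplication operator, half the sum and half the difference
of the other two give the two copies of `H₃(K)` in `Con`; this is `φ`, bijective because `Str = Der
+ L`. It respects brackets (`titsToCon_lie`) by a computation in which the trace terms cancel.

The substance is in the Jordan theory. The Jordan identity (`jordan_identity`), octonions included,
follows from the adjoint identity `A## = N(A)A` (`adjoint_adjoint`): its linearisations show that
`L_A` commutes with `L_{A#}`, and `A²` is a combination of `A#`, `A` and `1`. The Jordan identity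
makes `[L_a, L_b]` a derivation, whence `Str ⊆ Der + L` (`exists_of_mem_str`) and the Jacobi
identity in `Con` (`conBracket_isLieOn`). Conversely `Der ⊆ Str` because derivations are inner
(`der_le_span`), by positivity of the trace form.

Over `ℂ̃` the image in `Str` is `Der + L(H₃')`, a complement of the scalars, which are the centre
(`mem_center_str`); over `ℝ` only `Der` remains. Jacobi in the three `L₃` is not expanded: the
bracket is closed (`titsBracket_mem`) and is carried injectively into `Con`, `Str` and `Der`
(`isLieOn_of_injective`). -/

noncomputable section

open CompositionAlgebra (form)

/-! ### Identities in composition algebras -/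

namespace CompositionAlgebra

variable {K : Type*} [NonAssocRing K] [StarRing K] [Module ℝ K] [CompositionAlgebra K]

theorem ext_form {x y : K} (h : ∀ z, form x z = form y z) : x = y := by
  rw [← sub_eq_zero]
  exact form_nondeg _ fun z => by simp [h z]

theorem star_smul_real (r : ℝ) (x : K) : star (r • x) = r • star x := by
  simp only [star_eq, map_smul, LinearMap.smul_apply, smul_eq_mul, smul_sub, smul_smul]
  congr 2
  ring

theorem form_mul_left_polar (x y z : K) : form (x * y) (x * z) = form x x * form y z := by
  have h := form_mul x (y + z)
  simp only [mul_add, map_add, LinearMap.add_apply, form_mul, form_symm (x * z) (x * y),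
    form_symm z y] at h
  linarith

theorem form_mul_right_polar (x y z : K) : form (x * z) (y * z) = form x y * form z z := by
  have h := form_mul (x + y) z
  simp only [add_mul, map_add, LinearMap.add_apply, form_mul, form_symm (y * z) (x * z),
    form_symm y x] at h
  linarith

/-- Polarisation of `|xy|² = |x|²|y|²` in both factors. With one variable equal to 1 it yields the
adjunction rules below. -/
theorem form_mul_polar (x y z w : K) :
    form (x * y) (z * w) + form (z * y) (x * w) = 2 * form x z * form y w := by
  have h := form_mul_left_polar (x + z) y w
  simp only [add_mul, map_add, LinearMap.add_apply, form_mul_left_polar, form_symm z x] at h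
  linarith

theorem form_one [Nontrivial K] : form (1 : K) 1 = 1 := by
  have h : form (1 : K) 1 * form (1 : K) 1 = form (1 : K) 1 := by
    rw [← form_mul, one_mul]
  by_cases h0 : form (1 : K) 1 = 0
  · refine absurd (form_nondeg (1 : K) fun y => ?_) one_ne_zero
    have h2 := form_mul_left_polar (1 : K) 1 y
    rwa [one_mul, one_mul, h0, zero_mul] at h2
  · exact mul_right_cancel₀ h0 (h.trans (one_mul _).symm)

theorem form_star_star [Nontrivial K] (x y : K) : form (star x) (star y) = form x y := by
  simp [star_eq, form_one, form_symm (1 : K) y]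
  ring

variable [IsScalarTower ℝ K K] [SMulCommClass ℝ K K]

theorem form_mul_adj_left (x y w : K) : form (x * y) w = form y (star x * w) := by
  have h := form_mul_polar x y 1 w
  rw [one_mul, one_mul] at h
  simp only [star_eq, sub_mul, smul_mul_assoc, one_mul, map_sub, map_smul, smul_eq_mul]
  linarith

theorem form_mul_adj_right (x y w : K) : form (x * y) w = form x (w * star y) := by
  have h := form_mul_polar x y w 1
  rw [mul_one, mul_one, form_symm (w * y) x] at h
  simp only [star_eq, mul_sub, mul_smul_comm, mul_one, map_sub, map_smul, smul_eq_mul]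
  linarith

/-- A form of the alternative law: left multiplication by `star x` is adjoint to that by `x`, which
scales the form by `|x|²`. -/
theorem star_mul_cancel_left (x y : K) : star x * (x * y) = form x x • y :=
  ext_form fun z => by
    rw [form_mul_adj_left, star_star, form_mul_left_polar]
    simp

theorem mul_star_cancel_right (x y : K) : (x * y) * star y = form y y • x :=
  ext_form fun z => by
    rw [form_mul_adj_right, star_star, form_mul_right_polar]
    simp [mul_comm]

theorem mul_star_mul_cancel_left (x y : K) [Nontrivial K] : x * (star x * y) = form x x • y := by
  have h := star_mul_cancel_left (star x) y
  rwa [star_star, form_star_star] at h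

/-- The right side is `x(yz)x`, expressed through the form. With the cancellation laws it stands in
for associativity when the double adjoint is computed. -/
theorem middle_moufang (x y z : K) [Nontrivial K] :
    (x * y) * (z * x) = (2 * form x (star (y * z))) • x - form x x • star (y * z) :=
  ext_form fun w => by
    rw [form_mul_adj_right, star_mul]
    have h := form_mul_polar x y w (star x * star z)
    have h1 : form y (star x * star z) = form x (star (y * z)) := by
      rw [← form_mul_adj_left, form_mul_adj_right, star_mul]
    have h2 : form (w * y) (star z) = form w (star (y * z)) := by
      rw [form_mul_adj_right, star_mul]
    rw [mul_star_mul_cancel_left, h1, map_smul, h2] at h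
    simp only [map_smul, smul_eq_mul, map_sub, LinearMap.sub_apply, LinearMap.smul_apply,
      form_symm _ w] at h ⊢
    linarith

/-- The real part of a triple product is invariant under cyclic rotation; adjunction moves a factor
from one end to the other. -/
theorem form_cyclic (x y z : K) [Nontrivial K] :
    form (star (z * x)) y = form (star (y * z)) x := by
  have h1 : form (star (z * x)) y = form (z * x) (star y) := by
    rw [← form_star_star, star_star]
  rw [h1, form_mul_adj_left, form_symm, star_mul]

theorem form_cyclic' (x y z : K) [Nontrivial K] :
    form (star (x * y)) z = form (star (y * z)) x := by
  rw [form_cyclic z x y, form_cyclic]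

end CompositionAlgebra

namespace CompositionAlgebra

variable {K : Type*} [NonAssocRing K] [StarRing K] [Module ℝ K] [CompositionAlgebra K]
  [IsScalarTower ℝ K K] [SMulCommClass ℝ K K]

theorem star_mul_self_eq (x : K) : star x * x = form x x • (1 : K) := by
  simpa using star_mul_cancel_left x 1

theorem mul_star_self_eq (x : K) : x * star x = form x x • (1 : K) := by
  simpa using mul_star_cancel_right 1 x

theorem star_mul_add_star_mul (x y : K) : star x * y + star y * x = (2 * form x y) • (1 : K) := by
  have h := star_mul_self_eq (x + y)
  simp only [star_add, add_mul, mul_add, map_add, LinearMap.add_apply, star_mul_self_eq,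
    form_symm y x, add_smul] at h
  rw [two_mul, add_smul]
  linear_combination (norm := module) h

theorem mul_star_add_mul_star (x y : K) : x * star y + y * star x = (2 * form x y) • (1 : K) := by
  have h := mul_star_self_eq (x + y)
  simp only [star_add, add_mul, mul_add, map_add, LinearMap.add_apply, mul_star_self_eq,
    form_symm y x, add_smul] at h
  rw [two_mul, add_smul]
  linear_combination (norm := module) h

end CompositionAlgebra

/-! ### Hermitian matrices in coordinates -/

namespace H3

open CompositionAlgebra

variable {K : Type*} [NonAssocRing K] [StarRing K] [Module ℝ K] [CompositionAlgebra K]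

/-- The hermitian matrix with diagonal `α, β, γ` and entries `x, y, z` in the places
`(2,3), (3,1), (1,2)`. -/
def mk (α β γ : ℝ) (x y z : K) : H3 K :=
  ⟨!![α • 1, z, star y; star z, β • 1, x; y, star x, γ • 1], by
    change Matrix.conjTranspose _ = _
    ext i j
    fin_cases i <;> fin_cases j <;> simp [star_smul_real]⟩

theorem mat_mk (α β γ : ℝ) (x y z : K) :
    mat (mk α β γ x y z) = !![α • 1, z, star y; star z, β • 1, x; y, star x, γ • 1] := rfl

theorem mat_mk_00 (α β γ : ℝ) (x y z : K) : mat (mk α β γ x y z) 0 0 = α • (1 : K) := rfl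

theorem mat_mk_01 (α β γ : ℝ) (x y z : K) : mat (mk α β γ x y z) 0 1 = z := rfl

theorem mat_mk_02 (α β γ : ℝ) (x y z : K) : mat (mk α β γ x y z) 0 2 = star y := rfl

theorem mat_mk_10 (α β γ : ℝ) (x y z : K) : mat (mk α β γ x y z) 1 0 = star z := rfl

theorem mat_mk_11 (α β γ : ℝ) (x y z : K) : mat (mk α β γ x y z) 1 1 = β • (1 : K) := rfl

theorem mat_mk_12 (α β γ : ℝ) (x y z : K) : mat (mk α β γ x y z) 1 2 = x := rfl

theorem mat_mk_20 (α β γ : ℝ) (x y z : K) : mat (mk α β γ x y z) 2 0 = y := rfl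

theorem mat_mk_21 (α β γ : ℝ) (x y z : K) : mat (mk α β γ x y z) 2 1 = star x := rfl

theorem mat_mk_22 (α β γ : ℝ) (x y z : K) : mat (mk α β γ x y z) 2 2 = γ • (1 : K) := rfl

theorem star_mat (A : H3 K) (i j : Fin 3) : star (mat A i j) = mat A j i :=
  congrFun (congrFun (show (mat A).conjTranspose = mat A from A.2) j) i

theorem ext_entries {A B : H3 K} (h00 : mat A 0 0 = mat B 0 0) (h11 : mat A 1 1 = mat B 1 1)
    (h22 : mat A 2 2 = mat B 2 2) (h12 : mat A 1 2 = mat B 1 2) (h20 : mat A 2 0 = mat B 2 0)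
    (h01 : mat A 0 1 = mat B 0 1) : A = B := by
  apply mat_injective
  ext i j
  fin_cases i <;> fin_cases j
  · exact h00
  · exact h01
  · exact (star_mat A 2 0).symm.trans ((congrArg star h20).trans (star_mat B 2 0))
  · exact (star_mat A 0 1).symm.trans ((congrArg star h01).trans (star_mat B 0 1))
  · exact h11
  · exact h12
  · exact h20
  · exact (star_mat A 1 2).symm.trans ((congrArg star h12).trans (star_mat B 1 2))
  · exact h22

theorem mat_diag (A : H3 K) (i : Fin 3) : mat A i i = form (mat A i i) 1 • (1 : K) := by
  have h := star_mat A i i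
  rw [star_eq, sub_eq_iff_eq_add, mul_smul, two_smul, ← two_smul ℝ (mat A i i)] at h
  have h2 : (2 : ℝ) • (form (mat A i i) 1 • (1 : K) - mat A i i) = 0 := by
    rw [smul_sub, ← h, two_smul, sub_self]
  rw [smul_eq_zero] at h2
  rcases h2 with h2 | h2
  · norm_num at h2
  · exact (sub_eq_zero.mp h2).symm

theorem eq_mk (A : H3 K) : A = mk (form (mat A 0 0) 1) (form (mat A 1 1) 1) (form (mat A 2 2) 1)
    (mat A 1 2) (mat A 2 0) (mat A 0 1) := by
  apply ext_entries
  all_goals first | exact mat_diag _ _ | rfl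

theorem exists_eq_mk (A : H3 K) : ∃ α β γ x y z, A = mk α β γ x y z :=
  ⟨_, _, _, _, _, _, eq_mk A⟩

theorem mk_add (α β γ α' β' γ' : ℝ) (x y z x' y' z' : K) :
    mk α β γ x y z + mk α' β' γ' x' y' z' =
      mk (α + α') (β + β') (γ + γ') (x + x') (y + y') (z + z') := by
  apply ext_entries <;> simp [mat_mk, add_smul]

theorem smul_mk (r α β γ : ℝ) (x y z : K) :
    r • mk α β γ x y z = mk (r * α) (r * β) (r * γ) (r • x) (r • y) (r • z) := by
  apply ext_entries <;> simp [mat_mk, mul_smul]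

theorem mk_sub (α β γ α' β' γ' : ℝ) (x y z x' y' z' : K) :
    mk α β γ x y z - mk α' β' γ' x' y' z' =
      mk (α - α') (β - β') (γ - γ') (x - x') (y - y') (z - z') := by
  apply ext_entries <;> simp [mat_mk, sub_smul]

theorem neg_mk (α β γ : ℝ) (x y z : K) :
    -mk α β γ x y z = mk (-α) (-β) (-γ) (-x) (-y) (-z) := by
  apply ext_entries <;> simp [mat_mk]

theorem mat_idMatrix : mat (idMatrix K) = 1 := rfl

theorem idMatrix_eq : idMatrix K = mk 1 1 1 0 0 0 := by
  apply ext_entries <;> simp [mat_idMatrix, mat_mk]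

theorem zero_eq : (0 : H3 K) = mk 0 0 0 0 0 0 := by
  apply ext_entries <;> simp [mat_mk]

theorem trace_mk (α β γ : ℝ) (x y z : K) :
    (mat (mk α β γ x y z)).trace = (α + β + γ) • (1 : K) := by
  simp [mat_mk, Matrix.trace, Fin.sum_univ_three, add_smul]

theorem reTrace_mk [Nontrivial K] (α β γ : ℝ) (x y z : K) :
    reTrace K (mk α β γ x y z) = α + β + γ := by
  simp [reTrace, trace_mk, form_one]

variable (K) in
theorem H3'_eq_ker [Nontrivial K] : H3' K = LinearMap.ker (reTrace K) := by
  ext A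
  obtain ⟨α, β, γ, x, y, z, rfl⟩ := exists_eq_mk A
  simp [H3', trace_mk, reTrace_mk]

variable [IsScalarTower ℝ K K] [SMulCommClass ℝ K K]

/-- Only products of two elements of `K` occur, so no associativity enters. The placement of `x, y,
z` makes the formula invariant under simultaneous rotation of `(α, β, γ)` and `(x, y, z)`. -/
theorem jmul_mk (α β γ α' β' γ' : ℝ) (x y z x' y' z' : K) :
    jmul K (mk α β γ x y z) (mk α' β' γ' x' y' z') =
      mk (2 * (α * α' + form y y' + form z z')) (2 * (β * β' + form x x' + form z z'))
        (2 * (γ * γ' + form x x' + form y y'))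
        (star (y * z') + star (y' * z) + (β + γ) • x' + (β' + γ') • x)
        (star (z * x') + star (z' * x) + (γ + α) • y' + (γ' + α') • y)
        (star (x * y') + star (x' * y) + (α + β) • z' + (α' + β') • z) := by
  have hx := star_mul_add_star_mul x x'
  have hx' := mul_star_add_mul_star x x'
  have hy := star_mul_add_star_mul y y'
  have hy' := mul_star_add_mul_star y y'
  have hz := star_mul_add_star_mul z z'
  have hz' := mul_star_add_mul_star z z'
  apply ext_entries <;>
    simp only [mat_jmul, Matrix.add_apply, Matrix.mul_apply, Fin.sum_univ_three,
      mat_mk_00, mat_mk_01, mat_mk_02, mat_mk_10, mat_mk_11, mat_mk_12, mat_mk_20,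
      mat_mk_21, mat_mk_22] <;>
    simp only [star_mul, smul_mul_assoc, mul_smul_comm, one_mul, mul_one]
  · linear_combination (norm := module) hy + hz'
  · linear_combination (norm := module) hz + hx'
  · linear_combination (norm := module) hx + hy'
  · module
  · module
  · module

theorem trForm_mk [Nontrivial K] (α β γ α' β' γ' : ℝ) (x y z x' y' z' : K) :
    trForm K (mk α β γ x y z) (mk α' β' γ' x' y' z') =
      2 * (α * α' + β * β' + γ * γ') + 4 * (form x x' + form y y' + form z z') := by
  simp [trForm, jmul_mk, reTrace_mk]
  ring

theorem jmul_comm (A B : H3 K) : jmul K A B = jmul K B A := by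
  apply mat_injective
  rw [mat_jmul, mat_jmul, add_comm]

theorem trForm_comm (A B : H3 K) : trForm K A B = trForm K B A :=
  congrArg (reTrace K) (jmul_comm A B)

/-- The terms trilinear in the off-diagonal entries match by cyclicity of the real part. -/
theorem trForm_assoc [Nontrivial K] (A B C : H3 K) :
    trForm K (jmul K A B) C = trForm K A (jmul K B C) := by
  obtain ⟨a₁, a₂, a₃, x, y, z, rfl⟩ := exists_eq_mk A
  obtain ⟨b₁, b₂, b₃, x', y', z', rfl⟩ := exists_eq_mk B
  obtain ⟨c₁, c₂, c₃, x'', y'', z'', rfl⟩ := exists_eq_mk C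
  simp only [jmul_mk, trForm_mk, map_add, map_smul, LinearMap.add_apply, LinearMap.smul_apply,
    smul_eq_mul, form_symm x (star _), form_symm y (star _), form_symm z (star _)]
  linear_combination 4 * (form_cyclic x' y'' z + form_cyclic x y'' z' + form_cyclic' x y' z'' +
    form_cyclic' x' y z'' - form_cyclic x' y z'' - form_cyclic' x' y'' z - form_cyclic' x'' y' z -
    form_cyclic x'' y z')

end H3

/-! ### The Freudenthal product and the Jordan identity -/

namespace H3

open CompositionAlgebra

variable {K : Type*} [NonAssocRing K] [StarRing K] [Module ℝ K] [CompositionAlgebra K]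
  [IsScalarTower ℝ K K] [SMulCommClass ℝ K K]

/-- The Freudenthal product, the polarisation of the quadratic adjoint on `H₃(K)`. -/
def cross : H3 K →ₗ[ℝ] H3 K →ₗ[ℝ] H3 K :=
  LinearMap.mk₂ ℝ (fun A B => jmul K A B - reTrace K A • B - reTrace K B • A +
      (reTrace K A * reTrace K B - 1 / 2 * trForm K A B) • idMatrix K)
    (by intros; simp only [map_add, LinearMap.add_apply]; module)
    (by intros; simp only [map_smul, LinearMap.smul_apply, smul_eq_mul]; module)
    (by intros; simp only [map_add]; module)
    (by intros; simp only [map_smul, smul_eq_mul]; module)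

theorem cross_apply (A B : H3 K) : cross A B = jmul K A B - reTrace K A • B - reTrace K B • A +
      (reTrace K A * reTrace K B - 1 / 2 * trForm K A B) • idMatrix K := rfl

theorem cross_comm (A B : H3 K) : cross A B = cross B A := by
  rw [cross_apply, cross_apply, jmul_comm, trForm_comm A B]
  module

theorem cross_mk [Nontrivial K] (α β γ α' β' γ' : ℝ) (x y z x' y' z' : K) :
    cross (mk α β γ x y z) (mk α' β' γ' x' y' z') =
      mk (β * γ' + β' * γ - 2 * form x x') (γ * α' + γ' * α - 2 * form y y')
        (α * β' + α' * β - 2 * form z z')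
        (star (y * z') + star (y' * z) - α • x' - α' • x)
        (star (z * x') + star (z' * x) - β • y' - β' • y)
        (star (x * y') + star (x' * y) - γ • z' - γ' • z) := by
  rw [cross_apply, jmul_mk, idMatrix_eq, trForm_mk, reTrace_mk, reTrace_mk, smul_mk, smul_mk,
    smul_mk, mk_sub, mk_sub, mk_add]
  congr 1
  · ring
  · ring
  · ring
  · module
  · module
  · module

theorem trForm_idMatrix [Nontrivial K] (A : H3 K) : trForm K A (idMatrix K) = 2 * reTrace K A := by
  obtain ⟨a₁, a₂, a₃, x, y, z, rfl⟩ := exists_eq_mk A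
  simp [idMatrix_eq, trForm_mk, reTrace_mk]

theorem trForm_cross_assoc [Nontrivial K] (A B C : H3 K) :
    trForm K (cross A B) C = trForm K A (cross B C) := by
  simp only [cross_apply, map_add, map_sub, map_smul, LinearMap.add_apply, LinearMap.sub_apply,
    LinearMap.smul_apply, smul_eq_mul, trForm_assoc, trForm_idMatrix, trForm_comm (idMatrix K) C]
  ring

/-- The (2,3) entry of `A## = N(A)A`. Expansion produces `(xy)(zx)`, `(xy)ȳ` and `z̄(zx)`, which the
Moufang identity and the cancellation laws evaluate. -/
theorem adjoint_entry [Nontrivial K] (α β γ : ℝ) (x y z : K) :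
    star ((star (z * x) - β • y) * (star (x * y) - γ • z)) -
        (β * γ - form x x) • (star (y * z) - α • x) =
      (α * β * γ - α * form x x - β * form y y - γ * form z z + 2 * form (star (y * z)) x) • x := by
  have h1 := middle_moufang x y z
  have h2 := mul_star_cancel_right x y
  have h3 := star_mul_cancel_left z x
  rw [form_symm (star (y * z)) x]
  rw [star_mul] at h1
  simp only [star_mul, star_sub, star_star, star_smul_real, sub_mul, mul_sub, smul_mul_assoc,
    mul_smul_comm, h1, h2, h3]
  module

theorem adjoint_diag [Nontrivial K] (α β γ : ℝ) (x y z : K) :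
    (γ * α - form y y) * (α * β - form z z) - form (star (y * z) - α • x) (star (y * z) - α • x) =
      (α * β * γ - α * form x x - β * form y y - γ * form z z + 2 * form (star (y * z)) x) * α := by
  simp only [map_sub, LinearMap.sub_apply, map_smul, LinearMap.smul_apply, smul_eq_mul,
    form_star_star, form_mul, form_symm x (star (y * z))]
  ring

/-- So `A × A = 2A#`; this normalisation fixes the constants below. -/
theorem cross_self_mk [Nontrivial K] (α β γ : ℝ) (x y z : K) :
    cross (mk α β γ x y z) (mk α β γ x y z) =
      (2 : ℝ) • mk (β * γ - form x x) (γ * α - form y y) (α * β - form z z)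
        (star (y * z) - α • x) (star (z * x) - β • y) (star (x * y) - γ • z) := by
  rw [cross_mk, smul_mk]
  congr 1
  · ring
  · ring
  · ring
  · module
  · module
  · module

/-- This is `A## = N(A)A`; the scalar equals `8N(A)`. The remaining entries are rotations of one
diagonal and one off-diagonal entry, with `h1`, `h2` identifying the rotated norms. -/
theorem adjoint_adjoint [Nontrivial K] (A : H3 K) :
    cross (cross A A) (cross A A) = (2 / 3 * trForm K (cross A A) A) • A := by
  obtain ⟨α, β, γ, x, y, z, rfl⟩ := exists_eq_mk A
  have h1 := form_cyclic x y z
  have h2 := form_cyclic' x y z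
  have hN : 2 / 3 * trForm K (cross (mk α β γ x y z) (mk α β γ x y z)) (mk α β γ x y z) =
      8 * (α * β * γ - α * form x x - β * form y y - γ * form z z +
        2 * form (star (y * z)) x) := by
    rw [cross_self_mk, map_smul, LinearMap.smul_apply, trForm_mk]
    simp only [map_sub, LinearMap.sub_apply, map_smul, LinearMap.smul_apply, smul_eq_mul, h1, h2]
    ring
  rw [hN, cross_self_mk, map_smul, map_smul, LinearMap.smul_apply, cross_self_mk, smul_smul,
    smul_smul, mul_smul, smul_mk, smul_mk, smul_mk]
  congr 1
  · linear_combination 8 * adjoint_diag α β γ x y z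
  · linear_combination 8 * adjoint_diag β γ α y z x + 16 * β * h1
  · linear_combination 8 * adjoint_diag γ α β z x y + 16 * γ * h2
  · rw [adjoint_entry α β γ x y z]
    module
  · have := adjoint_entry β γ α y z x
    rw [h1] at this
    rw [this]
    module
  · have := adjoint_entry γ α β z x y
    rw [h2] at this
    rw [this]
    module

theorem adjoint_polar [Nontrivial K] (A Y : H3 K) :
    cross (cross A A) (cross A Y) =
      (1 / 6 * trForm K (cross A A) A) • Y + (1 / 2 * trForm K (cross A A) Y) • A := by
  have h (t : ℝ) := adjoint_adjoint (A + t • Y)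
  have e1 : trForm K (cross A Y) A = trForm K (cross A A) Y := by
    rw [trForm_cross_assoc, cross_comm Y A, ← trForm_cross_assoc]
  have e2 : trForm K (cross A Y) Y = trForm K (cross Y Y) A := by
    rw [trForm_cross_assoc, trForm_comm]
  simp only [map_add, map_smul, LinearMap.add_apply, LinearMap.smul_apply, smul_eq_mul,
    cross_comm Y A, e1, e2, cross_comm (cross A Y) (cross A A), cross_comm (cross Y Y) (cross A A),
    cross_comm (cross Y Y) (cross A Y)] at h
  -- Differences at `±t` remove even powers, and the weights remove the cubic one and leave a
  -- quarter of the coefficient of `t`, which on the left is `4 (A × A) × (A × Y)`.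
  linear_combination (norm := module) (1 / 6 : ℝ) • (h 1 - h (-1)) - (1 / 48 : ℝ) • (h 2 - h (-2))

theorem trForm_nondeg [Nontrivial K] (A : H3 K) (h : ∀ B, trForm K A B = 0) : A = 0 := by
  obtain ⟨α, β, γ, x, y, z, rfl⟩ := exists_eq_mk A
  rw [zero_eq]
  have h1 := h (mk 1 0 0 0 0 0)
  have h2 := h (mk 0 1 0 0 0 0)
  have h3 := h (mk 0 0 1 0 0 0)
  have h4 : x = 0 := form_nondeg x fun w => by simpa [trForm_mk] using h (mk 0 0 0 w 0 0)
  have h5 : y = 0 := form_nondeg y fun w => by simpa [trForm_mk] using h (mk 0 0 0 0 w 0)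
  have h6 : z = 0 := form_nondeg z fun w => by simpa [trForm_mk] using h (mk 0 0 0 0 0 w)
  simp [trForm_mk] at h1 h2 h3
  rw [h1, h2, h3, h4, h5, h6]

/-- The transpose of `adjoint_polar`: each `Y ↦ A × Y` is symmetric for the nondegenerate trace
form. -/
theorem adjoint_polar' [Nontrivial K] (A Y : H3 K) :
    cross A (cross (cross A A) Y) =
      (1 / 6 * trForm K (cross A A) A) • Y + (1 / 2 * trForm K A Y) • cross A A := by
  rw [← sub_eq_zero]
  refine trForm_nondeg _ fun W => ?_
  have h : trForm K (cross A (cross (cross A A) Y)) W =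
      trForm K Y (cross (cross A A) (cross A W)) := by
    rw [cross_comm, trForm_cross_assoc, cross_comm (cross A A), trForm_cross_assoc]
  rw [map_sub, LinearMap.sub_apply, h, adjoint_polar]
  simp only [map_add, map_smul, LinearMap.add_apply, LinearMap.smul_apply, smul_eq_mul,
    trForm_comm Y A]
  ring

theorem jmul_eq_cross (A B : H3 K) : jmul K A B = cross A B + reTrace K A • B + reTrace K B • A -
      (reTrace K A * reTrace K B - 1 / 2 * trForm K A B) • idMatrix K := by
  rw [cross_apply]
  module

theorem jmul_idMatrix (A : H3 K) : jmul K A (idMatrix K) = (2 : ℝ) • A := by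
  have h := jmul_unit K A
  rw [unit, map_smul] at h
  rw [← h, smul_smul, h]
  norm_num

theorem reTrace_idMatrix [Nontrivial K] : reTrace K (idMatrix K) = 3 := by
  rw [idMatrix_eq, reTrace_mk]
  norm_num

theorem reTrace_cross [Nontrivial K] (A B : H3 K) :
    reTrace K (cross A B) = reTrace K A * reTrace K B - 1 / 2 * trForm K A B := by
  have h : reTrace K (jmul K A B) = trForm K A B := rfl
  simp only [cross_apply, map_add, map_sub, map_smul, smul_eq_mul, h, reTrace_idMatrix]
  ring

/-- Written in terms of `×`, the quartic terms are `(A × A) × (A × Y)` and `A × ((A × A) × Y)`, and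
the two linearisations of `A## = N(A)A` reduce both to multiples of `A`, `A × A` and `Y`. -/
theorem jmul_cross_self [Nontrivial K] (A Y : H3 K) :
    jmul K (cross A A) (jmul K A Y) = jmul K A (jmul K (cross A A) Y) := by
  have h1 := adjoint_polar A Y
  have h2 := adjoint_polar' A Y
  have h3 : trForm K (cross A A) (cross A Y) = trForm K A (cross (cross A A) Y) := by
    rw [trForm_comm, trForm_cross_assoc, cross_comm Y]
  rw [jmul_eq_cross A Y, jmul_eq_cross (cross A A) Y]
  simp only [map_add, map_sub, map_smul, jmul_idMatrix, jmul_comm A (cross A A)]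
  rw [jmul_eq_cross (cross A A) (cross A Y), jmul_eq_cross A (cross (cross A A) Y),
    jmul_eq_cross (cross A A) Y, jmul_eq_cross A Y, h1, h2, h3, reTrace_cross A Y,
    reTrace_cross (cross A A) Y]
  module

/-- `A · A` is a combination of `A × A`, `A` and the identity, and multiplication by each of these
commutes with `L_A`. -/
theorem jordan_identity [Nontrivial K] (A Y : H3 K) :
    jmul K (jmul K A A) (jmul K A Y) = jmul K A (jmul K (jmul K A A) Y) := by
  rw [jmul_eq_cross A A]
  simp only [map_add, map_sub, map_smul, LinearMap.add_apply, LinearMap.sub_apply,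
    LinearMap.smul_apply, jmul_cross_self, jmul_comm (idMatrix K), jmul_idMatrix]

end H3

/-! ### Unital Jordan algebras and the Kantor–Koecher construction -/

/-- The product `m` with unit `e` makes `V` a unital Jordan algebra. -/
structure IsUnitalJordan {V : Type*} [AddCommGroup V] [Module ℝ V] (m : V →ₗ[ℝ] V →ₗ[ℝ] V)
    (e : V) : Prop where
  comm : ∀ a b, m a b = m b a
  mul_unit : ∀ a, m a e = a
  jordan : ∀ a b, m (m a a) (m a b) = m a (m (m a a) b)

namespace IsUnitalJordan

variable {V : Type*} [AddCommGroup V] [Module ℝ V] {m : V →ₗ[ℝ] V →ₗ[ℝ] V} {e : V}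

theorem unit_mul (J : IsUnitalJordan m e) (a : V) : m e a = a := by
  rw [J.comm, J.mul_unit]

theorem linearized (J : IsUnitalJordan m e) (a b c d : V) :
    m (m a b) (m c d) + m (m b c) (m a d) + m (m c a) (m b d) =
      m c (m (m a b) d) + m a (m (m b c) d) + m b (m (m c a) d) := by
  have h1 := J.jordan (a + b + c) d
  have h2 := J.jordan (a + b) d
  have h3 := J.jordan (b + c) d
  have h4 := J.jordan (c + a) d
  have h5 := J.jordan a d
  have h6 := J.jordan b d
  have h7 := J.jordan c d
  simp only [map_add, LinearMap.add_apply, J.comm b a, J.comm c b, J.comm a c] at h1 h2 h3 h4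
  -- Inclusion–exclusion isolates the part trilinear in `a, b, c`; commutativity makes each term
  -- appear twice.
  linear_combination (norm := module) (1 / 2 : ℝ) • (h1 - h2 - h3 - h4 + h5 + h6 + h7)

/-- The left side of `linearized` is symmetric in all four variables, so exchanging `a` with `b`
does not change the right side; the resulting equation is the Leibniz rule for `[L_a, L_b]`. -/
theorem lie_mem_der (J : IsUnitalJordan m e) (a b : V) :
    ⁅(m a : Module.End ℝ V), m b⁆ ∈ Der m := by
  intro x y
  have h1 := J.linearized b x y a
  have h2 := J.linearized a b x y
  have h3 := J.linearized a x y b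
  have h4 := J.linearized b a x y
  simp only [Ring.lie_def, LinearMap.sub_apply, Module.End.mul_apply, map_sub]
  simp only [J.comm] at h1 h2 h3 h4 ⊢
  linear_combination (norm := module) h1 - h2 - h3 + h4

theorem lie_lie_mul (J : IsUnitalJordan m e) (a b c : V) :
    ⁅(m (m a b) : Module.End ℝ V), m c⁆ + ⁅(m (m b c) : Module.End ℝ V), m a⁆ +
      ⁅(m (m c a) : Module.End ℝ V), m b⁆ = 0 := by
  ext d
  simp only [Ring.lie_def, LinearMap.sub_apply, Module.End.mul_apply, LinearMap.add_apply,
    LinearMap.zero_apply]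
  linear_combination (norm := module) J.linearized a b c d

theorem _root_.Der.apply_mul {D : Module.End ℝ V} (hD : D ∈ Der m) (x y : V) :
    D (m x y) = m (D x) y + m x (D y) := hD x y

theorem _root_.Der.lie_mul {D : Module.End ℝ V} (hD : D ∈ Der m) (a : V) :
    ⁅D, (m a : Module.End ℝ V)⁆ = m (D a) := by
  ext b
  simp [Ring.lie_def, hD a b]

theorem der_unit (J : IsUnitalJordan m e) {D : Module.End ℝ V} (hD : D ∈ Der m) : D e = 0 := by
  have h := hD e e
  rwa [J.mul_unit, J.mul_unit, J.unit_mul, left_eq_add] at h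

/-- `Str = Der + L`, as far as it holds in every Jordan algebra. -/
theorem exists_of_mem_str (J : IsUnitalJordan m e) (T : Str m) :
    ∃ D ∈ Der m, (T : Module.End ℝ V) = D + m ((T : Module.End ℝ V) e) := by
  -- Closed under brackets because `[D + L_a, E + L_b] = ([D, E] + [L_a, L_b]) + L_{Db - Ea}`.
  let S : LieSubalgebra ℝ (Module.End ℝ V) :=
    { carrier := {T | T - m (T e) ∈ Der m}
      zero_mem' := by simp
      add_mem' := by
        intro A B hA hB
        have := (Der m).add_mem hA hB
        simp only [Set.mem_ofPred_eq, LinearMap.add_apply, map_add] at this ⊢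
        convert this using 1
        abel
      smul_mem' := by
        intro r A hA
        have := (Der m).smul_mem r hA
        simpa only [Set.mem_ofPred_eq, LinearMap.smul_apply, map_smul, smul_sub] using this
      lie_mem' := by
        intro A B hA hB
        have h1 := (Der m).add_mem ((Der m).lie_mem hA hB) (J.lie_mem_der (A e) (B e))
        have h2 := Der.lie_mul hA (B e)
        have h3 := Der.lie_mul hB (A e)
        have h4 : ⁅A, B⁆ e = (A - m (A e)) (B e) - (B - m (B e)) (A e) := by
          simp only [Ring.lie_def, LinearMap.sub_apply, Module.End.mul_apply, J.comm (A e) (B e)]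
          abel
        change ⁅A, B⁆ - m (⁅A, B⁆ e) ∈ Der m
        rw [h4, map_sub, ← h2, ← h3]
        convert h1 using 1
        simp only [sub_lie, lie_sub]
        rw [← lie_skew (m (A e)) B, ← lie_skew (m (A e)) (m (B e))]
        abel }
  have hS : Str m ≤ S := by
    refine LieSubalgebra.lieSpan_le.mpr ?_
    rintro _ ⟨a, rfl | rfl⟩
    · change m a - m (m a e) ∈ Der m
      rw [J.mul_unit, sub_self]
      exact (Der m).zero_mem
    · have h : m.flip a = m a := LinearMap.ext fun b => J.comm b a
      change m.flip a - m (m.flip a e) ∈ Der m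
      rw [h, J.mul_unit, sub_self]
      exact (Der m).zero_mem
  exact ⟨_, hS T.2, by abel⟩

theorem coe_dagger (T : Str m) : (Str.dagger m e T : Module.End ℝ V) =
    (T : Module.End ℝ V) - (2 : ℝ) • m ((T : Module.End ℝ V) e) := rfl

theorem coe_box (X Y : V) : (ConAlg.box m X Y : Module.End ℝ V) =
    (2 : ℝ) • m (m X Y) + (2 : ℝ) • ⁅(m X : Module.End ℝ V), m Y⁆ := rfl

/-- Both sides are twice the Jordan triple product `(XY)Z + X(YZ) - Y(XZ)`, symmetric in its outer
arguments. -/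
theorem box_apply_symm (J : IsUnitalJordan m e) (X Y Z : V) :
    (ConAlg.box m X Y : Module.End ℝ V) Z = (ConAlg.box m Z Y : Module.End ℝ V) X := by
  simp only [coe_box, LinearMap.add_apply, LinearMap.smul_apply, Ring.lie_def,
    LinearMap.sub_apply, Module.End.mul_apply, J.comm Z Y, J.comm Y X, J.comm Z (m X Y),
    J.comm (m Y Z) X, J.comm Z X]
  module

theorem dagger_box (J : IsUnitalJordan m e) (X Y : V) :
    Str.dagger m e (ConAlg.box m X Y) = -ConAlg.box m Y X := by
  apply Subtype.ext
  have h : (ConAlg.box m X Y : Module.End ℝ V) e = (2 : ℝ) • m X Y := by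
    simp [coe_box, Ring.lie_def, J.mul_unit, J.comm Y X]
  have h2 : ((-ConAlg.box m Y X : Str m) : Module.End ℝ V) = -(ConAlg.box m Y X) := rfl
  rw [coe_dagger, h, h2, coe_box, coe_box, J.comm Y X, ← lie_skew (m X) (m Y), map_smul]
  module

/-- `T ↦ T*` is `+1` on derivations and `-1` on multiplications, and this splitting is a grading
modulo 2. -/
theorem dagger_lie (J : IsUnitalJordan m e) (S T : Str m) :
    Str.dagger m e ⁅S, T⁆ = ⁅Str.dagger m e S, Str.dagger m e T⁆ := by
  apply Subtype.ext
  obtain ⟨D, hD, hS⟩ := J.exists_of_mem_str S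
  obtain ⟨E, hE, hT⟩ := J.exists_of_mem_str T
  rw [LieSubalgebra.coe_bracket, coe_dagger, coe_dagger, coe_dagger, LieSubalgebra.coe_bracket]
  generalize (S : Module.End ℝ V) e = a at *
  generalize (T : Module.End ℝ V) e = b at *
  have h : ⁅(S : Module.End ℝ V), (T : Module.End ℝ V)⁆ e = D b - E a := by
    rw [hS, hT]
    simp [Ring.lie_def, J.der_unit hD, J.der_unit hE, J.mul_unit, J.comm a b]
  rw [h, hS, hT, map_sub, ← Der.lie_mul hD, ← Der.lie_mul hE]
  simp only [lie_add, add_lie, lie_sub, sub_lie, lie_smul, smul_lie]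
  rw [← lie_skew (m a) E]
  module

/-- For a derivation this is the Leibniz rule. For `T = L_a` the multiplication part holds since
`[L_X, L_Y]` is a derivation, and the derivation part is `lie_lie_mul`. -/
theorem lie_box (J : IsUnitalJordan m e) (T : Str m) (X Y : V) :
    ⁅T, ConAlg.box m X Y⁆ = ConAlg.box m ((T : Module.End ℝ V) X) Y +
      ConAlg.box m X ((Str.dagger m e T : Module.End ℝ V) Y) := by
  apply Subtype.ext
  obtain ⟨D, hD, hT⟩ := J.exists_of_mem_str T
  have hadd (S S' : Str m) : ((S + S' : Str m) : Module.End ℝ V) = S + S' := rfl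
  rw [LieSubalgebra.coe_bracket, hadd, coe_dagger, coe_box, coe_box, coe_box]
  generalize (T : Module.End ℝ V) e = a at *
  rw [hT]
  have h1 : ⁅D, ⁅(m X : Module.End ℝ V), m Y⁆⁆ = ⁅(m (D X) : Module.End ℝ V), m Y⁆ +
      ⁅(m X : Module.End ℝ V), m (D Y)⁆ := by
    rw [leibniz_lie, Der.lie_mul hD, Der.lie_mul hD]
  have h2 := Der.lie_mul hD (m X Y)
  rw [hD X Y, map_add] at h2
  have h3 := Der.lie_mul (J.lie_mem_der X Y) a
  have h4 := J.lie_lie_mul a X Y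
  have h5 : ⁅(m X : Module.End ℝ V), m Y⁆ a = m X (m a Y) - m Y (m a X) := by
    simp [Ring.lie_def, J.comm _ a]
  rw [h5, map_sub, ← lie_skew, J.comm Y (m a X)] at h3
  rw [← lie_skew (m (m X Y)), ← lie_skew (m (m Y a)), J.comm Y a] at h4
  simp only [LinearMap.add_apply, LinearMap.sub_apply, LinearMap.smul_apply, map_add, map_sub,
    map_smul, lie_add, add_lie, lie_sub, lie_smul, h1]
  linear_combination (norm := module) (2 : ℝ) • (h2 - h3 - h4)

/-- The `Str` component of Jacobi is Jacobi in `Str` plus `lie_box`; the other two reduce to the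
outer symmetry of the triple product, the last one after passing through `T ↦ T*`. -/
theorem conBracket_isLieOn (J : IsUnitalJordan m e) : IsLieOn (conBracket m e) ⊤ where
  closed _ _ _ _ := trivial
  self := by
    rintro ⟨T, X, Y⟩ -
    simp [conBracket]
  jacobi := by
    rintro ⟨T₁, X₁, Y₁⟩ - ⟨T₂, X₂, Y₂⟩ - ⟨T₃, X₃, Y₃⟩ -
    have hl (S S' : Str m) (v : V) : ((⁅S, S'⁆ : Str m) : Module.End ℝ V) v =
      (S : Module.End ℝ V) ((S' : Module.End ℝ V) v) -
        (S' : Module.End ℝ V) ((S : Module.End ℝ V) v) := rfl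
    have ha (S S' : Str m) (v : V) : ((S + S' : Str m) : Module.End ℝ V) v =
      (S : Module.End ℝ V) v + (S' : Module.End ℝ V) v := rfl
    have hs (S S' : Str m) (v : V) : ((S - S' : Str m) : Module.End ℝ V) v =
      (S : Module.End ℝ V) v - (S' : Module.End ℝ V) v := rfl
    have hn (S : Str m) (v : V) : ((-S : Str m) : Module.End ℝ V) v =
      -(S : Module.End ℝ V) v := rfl
    refine Prod.ext ?_ (Prod.ext ?_ ?_)
    · have h := lie_jacobi T₁ T₂ T₃
      simp only [conBracket, LinearMap.mk₂_apply, lie_add, lie_sub, J.lie_box, map_sub,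
        LinearMap.sub_apply, Prod.fst_add, Prod.fst_zero]
      linear_combination (norm := abel) h
    · simp only [conBracket, LinearMap.mk₂_apply, Prod.snd_add, Prod.fst_add, Prod.fst_zero,
        Prod.snd_zero, hl, ha, hs, map_sub, J.box_apply_symm X₂ _ X₁, J.box_apply_symm X₃ _ X₂,
        J.box_apply_symm X₁ _ X₃]
      abel
    · simp only [conBracket, LinearMap.mk₂_apply, Prod.snd_add, Prod.snd_zero, map_sub, map_add,
        J.dagger_lie, J.dagger_box, hl, ha, hs, hn, J.box_apply_symm Y₂ _ Y₁,
        J.box_apply_symm Y₃ _ Y₂, J.box_apply_symm Y₁ _ Y₃]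
      abel

end IsUnitalJordan

/-! ### Derivations are inner -/

section InnerDerivations

variable {V : Type*} [AddCommGroup V] [Module ℝ V] [FiniteDimensional ℝ V]

/-- The square of an operator that is symmetric or skew for a positive definite form has nonzero
trace, unless the operator vanishes. -/
theorem eq_zero_of_trace_mul_self {B : LinearMap.BilinForm ℝ V} (hB : ∀ x y, B x y = B y x)
    (hpos : ∀ x, x ≠ 0 → 0 < B x x) {s : ℝ} (hs : s ≠ 0) {S : Module.End ℝ V}
    (hS : ∀ x y, B (S x) y = s * B x (S y)) (h : LinearMap.trace ℝ V (S * S) = 0) : S = 0 := by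
  obtain ⟨v, hv⟩ := LinearMap.BilinForm.exists_orthogonal_basis (B := B) ⟨fun x y => hB x y⟩
  have hvv (i) : B (v i) (v i) ≠ 0 := (hpos _ (v.ne_zero i)).ne'
  have hrepr (w : V) (i) : v.repr w i = B w (v i) / B (v i) (v i) := by
    rw [eq_div_iff (hvv i)]
    conv_rhs => rw [← v.sum_repr w]
    simp only [map_sum, map_smul, LinearMap.sum_apply, LinearMap.smul_apply, smul_eq_mul]
    rw [Finset.sum_eq_single i]
    · intro j _ hj
      have : B (v j) (v i) = 0 := hv hj
      rw [this, mul_zero]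
    · simp
  rw [LinearMap.trace_eq_matrix_trace ℝ v, Matrix.trace] at h
  -- In the orthogonal basis `tr(S²)` is `s` times the sum of the nonnegative numbers `B(Sv_i, Sv_i)
  -- / B(v_i, v_i)`.
  simp only [Matrix.diag_apply, LinearMap.toMatrix_apply, Module.End.mul_apply, hrepr, hS (S _),
    mul_div_assoc, ← Finset.mul_sum] at h
  have h2 := (Finset.sum_eq_zero_iff_of_nonneg ?_).mp ((mul_eq_zero.mp h).resolve_left hs)
  · refine v.ext fun i => ?_
    have h3 := h2 i (Finset.mem_univ i)
    by_contra h4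
    exact div_ne_zero (hpos _ h4).ne' (hvv i) h3
  · intro i _
    refine div_nonneg ?_ (hpos _ (v.ne_zero i)).le
    by_cases h4 : S (v i) = 0
    · simp [h4]
    · exact (hpos _ h4).le

/-- The derivations of a unital Jordan algebra with a positive definite associative form are
inner. -/
theorem IsUnitalJordan.der_le_span {m : V →ₗ[ℝ] V →ₗ[ℝ] V} {e : V} (J : IsUnitalJordan m e)
    {B : LinearMap.BilinForm ℝ V} (hB : ∀ x y, B x y = B y x) (hpos : ∀ x, x ≠ 0 → 0 < B x x)
    (hm : ∀ a x y, B (m a x) y = B x (m a y)) (hD : ∀ D ∈ Der m, ∀ x y, B (D x) y = -B x (D y))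
    {D : Module.End ℝ V} (h : D ∈ Der m) :
    D ∈ Submodule.span ℝ {T | ∃ a b, T = ⁅(m a : Module.End ℝ V), m b⁆} := by
  set W := Submodule.span ℝ {T | ∃ a b, T = ⁅(m a : Module.End ℝ V), m b⁆} with hW
  have hWD : W ≤ (Der m).toSubmodule := by
    rw [hW, Submodule.span_le]
    rintro _ ⟨a, b, rfl⟩
    exact J.lie_mem_der a b
  let κ : LinearMap.BilinForm ℝ (Module.End ℝ V) :=
    (LinearMap.mul ℝ (Module.End ℝ V)).compr₂ (LinearMap.trace ℝ V)
  have hκ (S T) : κ S T = LinearMap.trace ℝ V (S * T) := rfl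
  have hrefl : κ.IsRefl := fun S T hST => by
    rw [hκ] at hST ⊢
    rwa [LinearMap.trace_mul_comm]
  -- Some `T ∈ W` orthogonal to `W` has `tr(T²) = 0`, and it is skew, being a derivation; so it
  -- vanishes.
  have hc : IsCompl W (κ.orthogonal W) := by
    rw [LinearMap.BilinForm.isCompl_orthogonal_iff_disjoint hrefl, Submodule.disjoint_def]
    intro T hT hT'
    exact eq_zero_of_trace_mul_self hB hpos (neg_ne_zero.mpr one_ne_zero)
      (fun x y => by rw [hD T (hWD hT)]; ring) (hT' T hT)
  obtain ⟨w, hw, v, hv, rfl⟩ := Submodule.mem_sup.mp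
    (hc.sup_eq_top.symm ▸ Submodule.mem_top : D ∈ W ⊔ κ.orthogonal W)
  have hvD : v ∈ Der m := by
    have := (Der m).sub_mem h (hWD hw)
    rwa [add_sub_cancel_left] at this
  have hv0 : v = 0 := by
    ext b
    -- This trace equals `tr(L_{vb} [L_b, v]) = -tr(L_{vb}²)`. As `L_{vb}` is symmetric it vanishes,
    -- and so does `vb = L_{vb} e`.
    have h1 : κ ⁅(m (v b) : Module.End ℝ V), m b⁆ v = 0 :=
      hv _ (Submodule.subset_span ⟨v b, b, rfl⟩)
    rw [hκ, LinearMap.trace_lie_mul_eq, ← lie_skew,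
      Der.lie_mul hvD, mul_neg, map_neg, neg_eq_zero] at h1
    have h2 := eq_zero_of_trace_mul_self hB hpos one_ne_zero
      (fun x y => by rw [hm, one_mul]) h1
    rw [← J.mul_unit (v b), h2, LinearMap.zero_apply, LinearMap.zero_apply]
  rwa [hv0, add_zero]

end InnerDerivations

/-! ### Derivations and the centre of the structure algebra of `H₃(K)` -/

namespace H3

open CompositionAlgebra

variable {K : Type*} [NonAssocRing K] [StarRing K] [Module ℝ K] [CompositionAlgebra K]
  [IsScalarTower ℝ K K] [SMulCommClass ℝ K K] [Nontrivial K]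

variable (K) in
theorem isUnitalJordan : IsUnitalJordan (jmul K) (unit K) where
  comm := jmul_comm
  mul_unit := jmul_unit K
  jordan := jordan_identity

theorem trForm_pos (hpos : ∀ x : K, x ≠ 0 → 0 < form x x) (A : H3 K) (hA : A ≠ 0) :
    0 < trForm K A A := by
  obtain ⟨α, β, γ, x, y, z, rfl⟩ := exists_eq_mk A
  have hnn (x : K) : 0 ≤ form x x := by
    by_cases h : x = 0
    · simp [h]
    · exact (hpos x h).le
  have hz (x : K) (h : form x x = 0) : x = 0 := by
    by_contra h'
    exact (hpos x h').ne' h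
  rw [trForm_mk]
  have h1 := hnn x
  have h2 := hnn y
  have h3 := hnn z
  have h4 := mul_self_nonneg α
  have h5 := mul_self_nonneg β
  have h6 := mul_self_nonneg γ
  refine lt_of_le_of_ne (by linarith) fun h => hA ?_
  rw [zero_eq, mul_self_eq_zero.mp (by linarith : α * α = 0),
    mul_self_eq_zero.mp (by linarith : β * β = 0), mul_self_eq_zero.mp (by linarith : γ * γ = 0),
    hz x (by linarith), hz y (by linarith), hz z (by linarith)]

/-- The traceless matrices are spanned by the images of the inner derivations. -/
theorem mem_of_reTrace_eq_zero {P : Submodule ℝ (H3 K)}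
    (hP : ∀ A B C : H3 K, ⁅(jmul K A : Module.End ℝ (H3 K)), jmul K B⁆ C ∈ P) {A : H3 K}
    (hA : reTrace K A = 0) : A ∈ P := by
  obtain ⟨α, β, γ, x, y, z, rfl⟩ := exists_eq_mk A
  rw [reTrace_mk] at hA
  -- For `s = E₁₂ + E₂₁` one has `[L_s, L_{E₁₁}] s = 2(E₂₂ - E₁₁)`, and similarly for the places 2,
  -- 3. An off-diagonal `X` in the places `i, j` is `-[L_X, L_{E_ii}] E_jj`.
  have h1 := P.add_mem (P.smul_mem (-α / 2) (hP (mk 0 0 0 0 0 1) (mk 1 0 0 0 0 0) (mk 0 0 0 0 0 1)))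
    (P.smul_mem (γ / 2) (hP (mk 0 0 0 1 0 0) (mk 0 1 0 0 0 0) (mk 0 0 0 1 0 0)))
  have h2 := P.neg_mem (hP (mk 0 0 0 x 0 0) (mk 0 1 0 0 0 0) (mk 0 0 1 0 0 0))
  have h3 := P.neg_mem (hP (mk 0 0 0 0 y 0) (mk 0 0 1 0 0 0) (mk 1 0 0 0 0 0))
  have h4 := P.neg_mem (hP (mk 0 0 0 0 0 z) (mk 1 0 0 0 0 0) (mk 0 1 0 0 0 0))
  convert P.add_mem h1 (P.add_mem h2 (P.add_mem h3 h4)) using 1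
  obtain rfl : β = -α - γ := by linarith
  simp only [Ring.lie_def, LinearMap.sub_apply, Module.End.mul_apply, jmul_mk, mk_sub, mk_add,
    smul_mk, neg_mk]
  congr 1 <;> simp [form_one] <;> ring

variable [FiniteDimensional ℝ K]

instance : FiniteDimensional ℝ (H3 K) := inferInstanceAs (FiniteDimensional ℝ (hermitian K))

/-- The form `A ↦ tr L_A` kills `D A` since `L_{DA} = [D, L_A]`. It therefore vanishes on traceless
matrices but not at the identity, so it is a nonzero multiple of `reTrace`. -/
theorem reTrace_der {D : Module.End ℝ (H3 K)} (hD : D ∈ Der (jmul K)) (A : H3 K) :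
    reTrace K (D A) = 0 := by
  let τ : H3 K →ₗ[ℝ] ℝ := LinearMap.trace ℝ (H3 K) ∘ₗ jmul K
  have hτ {D : Module.End ℝ (H3 K)} (hD : D ∈ Der (jmul K)) (A : H3 K) : τ (D A) = 0 := by
    change LinearMap.trace ℝ (H3 K) (jmul K (D A)) = 0
    rw [← Der.lie_mul hD, LinearMap.trace_lie]
  have h0 (A : H3 K) (hA : reTrace K A = 0) : τ A = 0 :=
    mem_of_reTrace_eq_zero (P := LinearMap.ker τ)
      (fun A B C => hτ ((isUnitalJordan K).lie_mem_der A B) C) hA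
  have h1 : τ (idMatrix K) ≠ 0 := by
    have h2 : jmul K (idMatrix K) = (2 : ℝ) • (1 : Module.End ℝ (H3 K)) := by
      ext B
      rw [jmul_comm, jmul_idMatrix]
      rfl
    have : Nontrivial (H3 K) := ⟨idMatrix K, 0, fun h => by
      have := reTrace_idMatrix (K := K)
      rw [h, map_zero] at this
      norm_num at this⟩
    change LinearMap.trace ℝ (H3 K) (jmul K (idMatrix K)) ≠ 0
    rw [h2, map_smul, LinearMap.trace_one]
    exact smul_ne_zero two_ne_zero (Nat.cast_ne_zero.mpr Module.finrank_pos.ne')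
  have h2 := h0 (D A - (reTrace K (D A) / 3) • idMatrix K) (by simp [reTrace_idMatrix])
  rw [map_sub, hτ hD, map_smul, zero_sub, neg_eq_zero, smul_eq_zero] at h2
  rcases h2 with h2 | h2
  · linarith
  · exact absurd h2 h1

theorem trForm_der {D : Module.End ℝ (H3 K)} (hD : D ∈ Der (jmul K)) (A B : H3 K) :
    trForm K (D A) B = -trForm K A (D B) := by
  have h := reTrace_der hD (jmul K A B)
  rw [hD A B, map_add] at h
  exact eq_neg_of_add_eq_zero_left h

theorem der_le_str (hpos : ∀ x : K, x ≠ 0 → 0 < form x x) {D : Module.End ℝ (H3 K)}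
    (hD : D ∈ Der (jmul K)) : D ∈ Str (jmul K) := by
  have h := (isUnitalJordan K).der_le_span (B := trForm K) trForm_comm (trForm_pos hpos)
    (fun A X Y => by rw [jmul_comm, trForm_assoc]) (fun D hD => trForm_der hD) hD
  refine (Submodule.span_le (p := (Str (jmul K)).toSubmodule)).mpr ?_ h
  rintro _ ⟨A, B, rfl⟩
  exact (Str (jmul K)).lie_mem (Str.mulLeft (jmul K) A).2 (Str.mulLeft (jmul K) B).2

/-- The centre of the structure algebra consists of the scalars. -/
theorem mem_center_str (hpos : ∀ x : K, x ≠ 0 → 0 < form x x) (T : Str (jmul K)) :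
    T ∈ LieAlgebra.center ℝ (Str (jmul K)) ↔ ∃ r : ℝ, (T : Module.End ℝ (H3 K)) = r • 1 := by
  have J := isUnitalJordan K
  constructor
  · intro hT
    have hT' (A : H3 K) : ⁅(T : Module.End ℝ (H3 K)), jmul K A⁆ = 0 := by
      have h := (LieModule.mem_maxTrivSubmodule ℝ _ _ T).mp hT (Str.mulLeft (jmul K) A)
      rw [← lie_skew, neg_eq_zero] at h
      exact congrArg Subtype.val h
    obtain ⟨D, hD, hTD⟩ := J.exists_of_mem_str T
    generalize (T : Module.End ℝ (H3 K)) (unit K) = A at hTD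
    -- At the unit, `[D + L_A, L_B]` takes the value `D B`.
    have hA (B : H3 K) : D B = 0 ∧ ⁅(jmul K A : Module.End ℝ (H3 K)), jmul K B⁆ = 0 := by
      have h := hT' B
      rw [hTD, add_lie, Der.lie_mul hD] at h
      have h2 := congrArg (fun S : Module.End ℝ (H3 K) => S (unit K)) h
      have h3 : D B = 0 := by
        simpa [Ring.lie_def, jmul_unit, jmul_comm A B] using h2
      refine ⟨h3, ?_⟩
      rwa [h3, map_zero, zero_add] at h
    have hD0 : D = 0 := LinearMap.ext fun B => (hA B).1
    have hA' (B C : H3 K) : jmul K A (jmul K B C) = jmul K B (jmul K A C) := by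
      have h := congrArg (fun S : Module.End ℝ (H3 K) => S C) (hA B).2
      exact sub_eq_zero.mp h
    -- As `L_A` commutes with all multiplications, associativity of the form makes `A` orthogonal to
    -- every `[L_B, L_C] X`. By positivity its traceless part then vanishes.
    have horth (B : H3 K) (hB : reTrace K B = 0) : trForm K A B = 0 := by
      refine mem_of_reTrace_eq_zero (P := LinearMap.ker (trForm K A)) (fun B C X => ?_) hB
      rw [LinearMap.mem_ker, Ring.lie_def, LinearMap.sub_apply, Module.End.mul_apply,
        Module.End.mul_apply, map_sub, ← trForm_assoc, ← trForm_assoc, ← trForm_assoc,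
        ← trForm_assoc, jmul_comm (jmul K A B), jmul_comm (jmul K A C), ← hA', ← hA',
        jmul_comm B C, sub_self]
    refine ⟨2 / 3 * reTrace K A, ?_⟩
    have h0 : A - (reTrace K A / 3) • idMatrix K = 0 := by
      by_contra hne
      have h1 := trForm_pos hpos _ hne
      have h2 : reTrace K (A - (reTrace K A / 3) • idMatrix K) = 0 := by simp [reTrace_idMatrix]
      have h3 := horth _ h2
      have h4 : trForm K (idMatrix K) (A - (reTrace K A / 3) • idMatrix K) = 0 := by
        rw [trForm_comm, trForm_idMatrix, h2, mul_zero]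
      rw [map_sub (trForm K), LinearMap.sub_apply, h3, map_smul, LinearMap.smul_apply, h4,
        smul_zero, sub_zero] at h1
      exact lt_irrefl _ h1
    rw [hTD, hD0, zero_add]
    ext B
    rw [sub_eq_zero] at h0
    conv_lhs => rw [h0, jmul_comm, map_smul, jmul_idMatrix, smul_smul]
    rw [LinearMap.smul_apply, Module.End.one_apply]
    congr 1
    ring
  · rintro ⟨r, hr⟩
    refine (LieModule.mem_maxTrivSubmodule ℝ _ _ T).mpr fun S => ?_
    apply Subtype.ext
    rw [LieSubalgebra.coe_bracket, hr]
    simp [Ring.lie_def]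

end H3

/-! ### Transport of the Lie axioms -/

/-- A bracket is a Lie bracket if an injective linear map carries it to a Lie bracket. -/
theorem isLieOn_of_injective {V W : Type*} [AddCommGroup V] [Module ℝ V] [AddCommGroup W]
    [Module ℝ W] {b : V →ₗ[ℝ] V →ₗ[ℝ] V} {S : Submodule ℝ V} {c : W →ₗ[ℝ] W →ₗ[ℝ] W}
    (hc : IsLieOn c ⊤) (hS : ∀ u ∈ S, ∀ v ∈ S, b u v ∈ S) (φ : S →ₗ[ℝ] W)
    (hφ : Function.Injective φ)
    (hom : ∀ u v w : S, (w : V) = b u v → φ w = c (φ u) (φ v)) : IsLieOn b S := by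
  have key (w : S) (h : φ w = 0) : (w : V) = 0 := by
    rw [(map_eq_zero_iff φ hφ).mp h]
    rfl
  refine ⟨hS, fun u hu => ?_, fun u hu v hv w hw => ?_⟩
  · refine key ⟨b u u, hS u hu u hu⟩ ?_
    rw [hom ⟨u, hu⟩ ⟨u, hu⟩ _ rfl]
    exact hc.self _ trivial
  · let u' : S := ⟨u, hu⟩
    let v' : S := ⟨v, hv⟩
    let w' : S := ⟨w, hw⟩
    let uv : S := ⟨b u v, hS u hu v hv⟩
    let vw : S := ⟨b v w, hS v hv w hw⟩
    let wu : S := ⟨b w u, hS w hw u hu⟩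
    let x : S := ⟨b u (b v w), hS _ hu _ vw.2⟩
    let y : S := ⟨b v (b w u), hS _ hv _ wu.2⟩
    let z : S := ⟨b w (b u v), hS _ hw _ uv.2⟩
    refine key (x + y + z) ?_
    rw [map_add, map_add, hom u' vw x rfl, hom v' wu y rfl, hom w' uv z rfl, hom v' w' vw rfl,
      hom w' u' wu rfl, hom u' v' uv rfl]
    exact hc.jacobi _ trivial _ trivial _ trivial

/-- The bracket of a Lie algebra as a bilinear map. -/
def lieBilin (L : Type*) [LieRing L] [LieAlgebra ℝ L] : L →ₗ[ℝ] L →ₗ[ℝ] L :=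
  (LieAlgebra.ad ℝ L).toLinearMap

theorem isLieOn_lieBilin (L : Type*) [LieRing L] [LieAlgebra ℝ L] : IsLieOn (lieBilin L) ⊤ where
  closed _ _ _ _ := trivial
  self _ _ := lie_self _
  jacobi _ _ _ _ _ _ := lie_jacobi _ _ _

/-! ### Closure of the Tits bracket -/

namespace CompositionAlgebra

variable {K : Type*} [NonAssocRing K] [StarRing K] [Module ℝ K] [CompositionAlgebra K]
  [IsScalarTower ℝ K K] [SMulCommClass ℝ K K]

theorem halfComm_apply (x y : K) : halfComm K x y = (1 / 2 : ℝ) • (x * y - y * x) := rfl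

theorem halfComm_mem_imag (x y : K) : halfComm K x y ∈ Imag K := by
  have h : form (x * y) 1 = form (y * x) 1 := by
    rw [form_mul_adj_right, form_mul_adj_left, one_mul, mul_one]
  simp [Imag, halfComm_apply, h]

/-- By associativity left and right multiplications commute, so `[L_x, R_y]` drops out and `D_{x,y}`
is the inner derivation of `[x, y]`. -/
theorem derMap_apply (hK : ∀ x y z : K, x * y * z = x * (y * z)) (x y z : K) :
    derMap K x y z = (x * y - y * x) * z - z * (x * y - y * x) := by
  simp [derMap, Ring.lie_def, sub_mul, mul_sub, hK]
  abel

theorem derMap_mem_der (hK : ∀ x y z : K, x * y * z = x * (y * z)) (x y : K) :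
    derMap K x y ∈ Der (LinearMap.mul ℝ K) := by
  intro z w
  simp only [LinearMap.mul_apply', derMap_apply hK]
  generalize x * y - y * x = c
  simp only [sub_mul, mul_sub, hK]
  abel

end CompositionAlgebra

section Closed

open CompositionAlgebra

variable {K₁ K₂ : Type*}
  [NonAssocRing K₁] [StarRing K₁] [Module ℝ K₁] [CompositionAlgebra K₁]
  [IsScalarTower ℝ K₁ K₁] [SMulCommClass ℝ K₁ K₁] [Nontrivial K₁]
  [NonAssocRing K₂] [StarRing K₂] [Module ℝ K₂] [CompositionAlgebra K₂]
  [IsScalarTower ℝ K₂ K₂] [SMulCommClass ℝ K₂ K₂]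

theorem ast_apply (A B : H3 K₁) :
    ast K₁ A B = jmul K₁ A B - trForm K₁ A B • (1 / 3 : ℝ) • H3.idMatrix K₁ := rfl

theorem ast_mem (A B : H3 K₁) : ast K₁ A B ∈ H3' K₁ := by
  have h : reTrace K₁ (jmul K₁ A B) = trForm K₁ A B := rfl
  rw [H3.H3'_eq_ker, LinearMap.mem_ker, ast_apply, map_sub, map_smul, map_smul, h,
    H3.reTrace_idMatrix]
  simp

theorem titsPart₁_tmul (A B : H3 K₁) (x y : K₂) : titsPart₁ K₁ K₂ (A ⊗ₜ x) (B ⊗ₜ y) =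
    (-form x y) • ⁅(jmul K₁ A : Module.End ℝ (H3 K₁)), jmul K₁ B⁆ := rfl

theorem titsPart₂_tmul (A B : H3 K₁) (x y : K₂) : titsPart₂ K₁ K₂ (A ⊗ₜ x) (B ⊗ₜ y) =
    ast K₁ A B ⊗ₜ halfComm K₂ x y := rfl

theorem titsPart₃_tmul (A B : H3 K₁) (x y : K₂) : titsPart₃ K₁ K₂ (A ⊗ₜ x) (B ⊗ₜ y) =
    (1 / 6 * trForm K₁ A B) • derMap K₂ x y := rfl

theorem titsPart₁_mem (t s : H3 K₁ ⊗[ℝ] K₂) : titsPart₁ K₁ K₂ t s ∈ Der (jmul K₁) := by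
  induction t with
  | zero => simp
  | add a b ha hb => rw [map_add]; exact (Der _).add_mem ha hb
  | tmul A x =>
    induction s with
    | zero => simp
    | add a b ha hb => rw [map_add]; exact (Der _).add_mem ha hb
    | tmul B y => exact (Der _).smul_mem _ ((H3.isUnitalJordan K₁).lie_mem_der A B)

theorem titsPart₂_mem (t s : H3 K₁ ⊗[ℝ] K₂) : titsPart₂ K₁ K₂ t s ∈
    Submodule.map₂ (TensorProduct.mk ℝ (H3 K₁) K₂) (H3' K₁) (Imag K₂) := by
  induction t with
  | zero => simp
  | add a b ha hb => rw [map_add]; exact Submodule.add_mem _ ha hb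
  | tmul A x =>
    induction s with
    | zero => simp
    | add a b ha hb => rw [map_add]; exact Submodule.add_mem _ ha hb
    | tmul B y => exact Submodule.apply_mem_map₂ _ (ast_mem A B) (halfComm_mem_imag x y)

theorem titsPart₃_mem (hK : ∀ x y z : K₂, x * y * z = x * (y * z)) (t s : H3 K₁ ⊗[ℝ] K₂) :
    titsPart₃ K₁ K₂ t s ∈ Der (LinearMap.mul ℝ K₂) := by
  induction t with
  | zero => simp
  | add a b ha hb => rw [map_add]; exact (Der _).add_mem ha hb
  | tmul A x =>
    induction s with
    | zero => simp
    | add a b ha hb => rw [map_add]; exact (Der _).add_mem ha hb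
    | tmul B y => exact (Der _).smul_mem _ (derMap_mem_der hK x y)

/-- The point that is not formal is that derivations of `H₃(K₁)` preserve tracelessness, by
`reTrace_der`. -/
theorem titsBracket_mem [FiniteDimensional ℝ K₁] (hK : ∀ x y z : K₂, x * y * z = x * (y * z))
    (hE : ∀ E ∈ Der (LinearMap.mul ℝ K₂), ∀ x ∈ Imag K₂, E x ∈ Imag K₂) :
    ∀ u ∈ L3 K₁ K₂, ∀ v ∈ L3 K₁ K₂, titsBracket K₁ K₂ u v ∈ L3 K₁ K₂ := by
  have hr {D : Module.End ℝ (H3 K₁)} (hD : D ∈ Der (jmul K₁)) :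
      Submodule.map₂ (TensorProduct.mk ℝ (H3 K₁) K₂) (H3' K₁) (Imag K₂) ≤
        (Submodule.map₂ (TensorProduct.mk ℝ (H3 K₁) K₂) (H3' K₁) (Imag K₂)).comap
          (D.rTensor K₂) := by
    refine Submodule.map₂_le.mpr fun A hA x hx => Submodule.apply_mem_map₂ _ ?_ hx
    rw [H3.H3'_eq_ker]
    exact H3.reTrace_der hD A
  have hl {E : Module.End ℝ K₂} (h : E ∈ Der (LinearMap.mul ℝ K₂)) :
      Submodule.map₂ (TensorProduct.mk ℝ (H3 K₁) K₂) (H3' K₁) (Imag K₂) ≤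
        (Submodule.map₂ (TensorProduct.mk ℝ (H3 K₁) K₂) (H3' K₁) (Imag K₂)).comap
          (E.lTensor (H3 K₁)) :=
    Submodule.map₂_le.mpr fun A hA x hx => Submodule.apply_mem_map₂ _ hA (hE E h x hx)
  rintro ⟨D, t, E⟩ ⟨hD, ht, h⟩ ⟨D', t', E'⟩ ⟨hD', ht', h'⟩
  exact ⟨(Der _).add_mem ((Der _).lie_mem hD hD') (titsPart₁_mem t t'),
    Submodule.add_mem _ (Submodule.add_mem _ (Submodule.sub_mem _ (hr hD ht') (hr hD' ht))
      (Submodule.sub_mem _ (hl h ht') (hl h' ht))) (titsPart₂_mem t t'),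
    (Der _).add_mem ((Der _).lie_mem h h') (titsPart₃_mem hK t t')⟩

/-- The contraction of `H₃(K₁) ⊗ K₂` with a linear form on `K₂`. -/
def contract (f : K₂ →ₗ[ℝ] ℝ) : H3 K₁ ⊗[ℝ] K₂ →ₗ[ℝ] H3 K₁ :=
  (TensorProduct.rid ℝ (H3 K₁)).toLinearMap ∘ₗ f.lTensor (H3 K₁)

theorem contract_mem (f : K₂ →ₗ[ℝ] ℝ) {t : H3 K₁ ⊗[ℝ] K₂}
    (ht : t ∈ Submodule.map₂ (TensorProduct.mk ℝ (H3 K₁) K₂) (H3' K₁) (Imag K₂)) :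
    contract f t ∈ H3' K₁ := by
  have h : Submodule.map₂ (TensorProduct.mk ℝ (H3 K₁) K₂) (H3' K₁) (Imag K₂) ≤
      (H3' K₁).comap (contract f) :=
    Submodule.map₂_le.mpr fun A hA x _ => (H3' K₁).smul_mem _ hA
  exact h ht

theorem der_one_eq_zero {E : Module.End ℝ K₂} (hE : E ∈ Der (LinearMap.mul ℝ K₂)) : E 1 = 0 := by
  have h := hE 1 1
  simpa using h

end Closed

/-! ### Derivations of the split quaternions -/

namespace SplitQuaternion

/-- The coefficient of `i`. -/
abbrev coeffI : SplitQuaternion →ₗ[ℝ] ℝ := QuaternionAlgebra.imIₗ _ _ _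

/-- The coefficient of `j`. -/
abbrev coeffJ : SplitQuaternion →ₗ[ℝ] ℝ := QuaternionAlgebra.imJₗ _ _ _

/-- The coefficient of `k`. -/
abbrev coeffK : SplitQuaternion →ₗ[ℝ] ℝ := QuaternionAlgebra.imKₗ _ _ _

theorem C_apply (a x : SplitQuaternion) : (C a : Module.End ℝ SplitQuaternion) x = a * x - x * a :=
  rfl

theorem coe_i : (i : SplitQuaternion) = ⟨0, 1, 0, 0⟩ := rfl

theorem coe_j : (j : SplitQuaternion) = ⟨0, 0, 1, 0⟩ := rfl

theorem coe_k : (k : SplitQuaternion) = ⟨0, 0, 0, 1⟩ := rfl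

theorem C_i (a b c : ℝ) : (C ⟨0, a, b, c⟩ : Module.End ℝ SplitQuaternion) i =
    (-2 * c) • (j : SplitQuaternion) + (-2 * b) • (k : SplitQuaternion) := by
  rw [C_apply]
  ext <;> simp [coe_i, coe_j, coe_k] <;> ring

theorem C_j (a b c : ℝ) : (C ⟨0, a, b, c⟩ : Module.End ℝ SplitQuaternion) j =
    (2 * c) • (i : SplitQuaternion) + (2 * a) • (k : SplitQuaternion) := by
  rw [C_apply]
  ext <;> simp [coe_i, coe_j, coe_k] <;> ring

theorem C_k (a b c : ℝ) : (C ⟨0, a, b, c⟩ : Module.End ℝ SplitQuaternion) k =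
    (-2 * b) • (i : SplitQuaternion) + (2 * a) • (j : SplitQuaternion) := by
  rw [C_apply]
  ext <;> simp [coe_i, coe_j, coe_k] <;> ring

theorem C_lie (a b c a' b' c' : ℝ) : ⁅(C ⟨0, a, b, c⟩ : Module.End ℝ SplitQuaternion),
    (C ⟨0, a', b', c'⟩ : Module.End ℝ SplitQuaternion)⁆ =
      C ⟨0, -2 * (b * c' - c * b'), -2 * (c * a' - a * c'), 2 * (a * b' - b * a')⟩ := by
  ext x <;> simp [Ring.lie_def, C_apply] <;> ring

/-- A derivation is determined by its values at `i` and `j`, and `i² = j² = 1`, `ij + ji = 0` leave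
three free coefficients. They are matched with `q` through `C_i` and `C_j`. -/
theorem der_eq_C {E : Module.End ℝ SplitQuaternion}
    (hE : E ∈ Der (LinearMap.mul ℝ SplitQuaternion)) :
    E = C ⟨0, 1 / 2 * (E j).imK, -1 / 2 * (E i).imK, 1 / 2 * (E j).imI⟩ := by
  have h1 := der_one_eq_zero hE
  have hij : (i : SplitQuaternion) * j = k := by ext <;> simp [coe_i, coe_j, coe_k]
  have hji : (j : SplitQuaternion) * i = -k := by ext <;> simp [coe_i, coe_j, coe_k]
  have hii : (i : SplitQuaternion) * i = 1 := by ext <;> simp [coe_i]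
  have hjj : (j : SplitQuaternion) * j = 1 := by ext <;> simp [coe_j]
  have e1 := hE i i
  have e2 := hE j j
  have e3 := hE i j
  have e4 := hE j i
  simp only [LinearMap.mul_apply', hij, hji, hii, hjj, h1, map_neg] at e1 e2 e3 e4
  have e5 : E i * j + i * E j + (E j * i + j * E i) = 0 := by rw [← e3, ← e4, add_neg_cancel]
  have hi : E i = (C ⟨0, 1 / 2 * (E j).imK, -1 / 2 * (E i).imK, 1 / 2 * (E j).imI⟩ :
      Module.End ℝ SplitQuaternion) i := by
    rw [C_i]
    simp only [QuaternionAlgebra.ext_iff] at e1 e2 e5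
    simp [coe_i, coe_j] at e1 e2 e5
    ext <;> simp [coe_i, coe_j, coe_k] <;> linarith
  have hj : E j = (C ⟨0, 1 / 2 * (E j).imK, -1 / 2 * (E i).imK, 1 / 2 * (E j).imI⟩ :
      Module.End ℝ SplitQuaternion) j := by
    rw [C_j]
    simp only [QuaternionAlgebra.ext_iff] at e1 e2 e5
    simp [coe_i, coe_j] at e1 e2 e5
    ext <;> simp [coe_i, coe_j, coe_k] <;> linarith
  set F : Der (LinearMap.mul ℝ SplitQuaternion) :=
    C ⟨0, 1 / 2 * (E j).imK, -1 / 2 * (E i).imK, 1 / 2 * (E j).imI⟩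
  have hk : E k = (F : Module.End ℝ SplitQuaternion) k := by
    have e6 := F.2 i j
    simp only [LinearMap.mul_apply', hij, ← hi, ← hj] at e6
    rw [e3, e6]
  have hF := der_one_eq_zero F.2
  ext1 x
  have hx : x = x.re • (1 : SplitQuaternion) + x.imI • (i : SplitQuaternion) +
      x.imJ • (j : SplitQuaternion) + x.imK • (k : SplitQuaternion) := by
    ext <;> simp [coe_i, coe_j, coe_k]
  rw [hx]
  simp only [map_add, map_smul, h1, hF, hi, hj, hk]

theorem mul_assoc' (x y z : SplitQuaternion) : x * y * z = x * (y * z) := mul_assoc x y z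

theorem mem_imag {x : SplitQuaternion} : x ∈ Imag SplitQuaternion ↔ x.re = 0 := by
  simp [Imag, form]

theorem der_mem_imag {E : Module.End ℝ SplitQuaternion}
    (hE : E ∈ Der (LinearMap.mul ℝ SplitQuaternion)) (x : SplitQuaternion) :
    E x ∈ Imag SplitQuaternion := by
  rw [der_eq_C hE, mem_imag, C_apply]
  simp
  ring

end SplitQuaternion

/-! ### The Tits bracket over the split quaternions in coordinates -/

section SplitQuaternionTits

open SplitQuaternion

variable {K : Type*} [NonAssocRing K] [StarRing K] [Module ℝ K] [CompositionAlgebra K]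
  [IsScalarTower ℝ K K] [SMulCommClass ℝ K K] [Nontrivial K]

/-- The element `D + A ⊗ i + B ⊗ j + C ⊗ k + C_q` of the Tits algebra over the split quaternions,
where `q = a i + b j + c k`. -/
def titsPoint (D : Module.End ℝ (H3 K)) (A B C : H3 K) (a b c : ℝ) : TitsSpace K SplitQuaternion :=
  (D, A ⊗ₜ[ℝ] (i : SplitQuaternion) + B ⊗ₜ[ℝ] (j : SplitQuaternion) + C ⊗ₜ[ℝ] (k : SplitQuaternion),
    SplitQuaternion.C ⟨0, a, b, c⟩)

theorem exists_eq_titsPoint {u : TitsSpace K SplitQuaternion} (hu : u ∈ L3 K SplitQuaternion) :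
    ∃ D ∈ Der (jmul K), ∃ A ∈ H3' K, ∃ B ∈ H3' K, ∃ C ∈ H3' K, ∃ a b c,
      u = titsPoint D A B C a b c := by
  obtain ⟨D, t, E⟩ := u
  obtain ⟨hD, ht, hE⟩ := hu
  refine ⟨D, hD, _, contract_mem coeffI ht, _,
    contract_mem coeffJ ht, _, contract_mem coeffK ht,
    1 / 2 * (E j).imK, -1 / 2 * (E i).imK, 1 / 2 * (E j).imI, ?_⟩
  refine congrArg₂ Prod.mk rfl (congrArg₂ Prod.mk ?_ (der_eq_C hE))
  -- `P` rebuilds a tensor from its `i, j, k` coordinates; it fixes `A ⊗ x` for imaginary `x`, hence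
  -- their span.
  let P : H3 K ⊗[ℝ] SplitQuaternion →ₗ[ℝ] H3 K ⊗[ℝ] SplitQuaternion :=
    (TensorProduct.mk ℝ (H3 K) SplitQuaternion).flip (i : SplitQuaternion) ∘ₗ contract coeffI +
    (TensorProduct.mk ℝ (H3 K) SplitQuaternion).flip (j : SplitQuaternion) ∘ₗ contract coeffJ +
    (TensorProduct.mk ℝ (H3 K) SplitQuaternion).flip (k : SplitQuaternion) ∘ₗ contract coeffK
  have hP : Submodule.map₂ (TensorProduct.mk ℝ (H3 K) SplitQuaternion) (H3' K)
      (Imag SplitQuaternion) ≤ LinearMap.eqLocus LinearMap.id P := by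
    refine Submodule.map₂_le.mpr fun A _ x hx => ?_
    have hx0 := mem_imag.mp hx
    have h : x = x.imI • (i : SplitQuaternion) + x.imJ • (j : SplitQuaternion) +
        x.imK • (k : SplitQuaternion) := by
      ext <;> simp [coe_i, coe_j, coe_k, hx0]
    change A ⊗ₜ x = (x.imI • A) ⊗ₜ[ℝ] (i : SplitQuaternion) +
      (x.imJ • A) ⊗ₜ[ℝ] (j : SplitQuaternion) + (x.imK • A) ⊗ₜ[ℝ] (k : SplitQuaternion)
    conv_lhs => rw [h]
    simp only [TensorProduct.tmul_add, TensorProduct.tmul_smul, TensorProduct.smul_tmul']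
  exact hP ht

theorem titsBracket_mk {K₂ : Type*} [NonAssocRing K₂] [StarRing K₂] [Module ℝ K₂]
    [CompositionAlgebra K₂] [IsScalarTower ℝ K₂ K₂] [SMulCommClass ℝ K₂ K₂]
    (D D' : Module.End ℝ (H3 K)) (t t' : H3 K ⊗[ℝ] K₂) (E E' : Module.End ℝ K₂) :
    titsBracket K K₂ (D, t, E) (D', t', E') =
      (⁅D, D'⁆ + titsPart₁ K K₂ t t',
        D.rTensor K₂ t' - D'.rTensor K₂ t + (E.lTensor (H3 K) t' - E'.lTensor (H3 K) t) +
          titsPart₂ K K₂ t t',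
        ⁅E, E'⁆ + titsPart₃ K K₂ t t') := rfl

theorem titsBracket_titsPoint (D D' : Module.End ℝ (H3 K)) (A B C A' B' C' : H3 K)
    (a b c a' b' c' : ℝ) :
    titsBracket K SplitQuaternion (titsPoint D A B C a b c) (titsPoint D' A' B' C' a' b' c') =
      titsPoint (⁅D, D'⁆ + ⁅(jmul K A : Module.End ℝ (H3 K)), jmul K A'⁆ +
          ⁅(jmul K B : Module.End ℝ (H3 K)), jmul K B'⁆ -
          ⁅(jmul K C : Module.End ℝ (H3 K)), jmul K C'⁆)
        (D A' - D' A + (-2 : ℝ) • (b • C' - c • B') + (2 : ℝ) • (b' • C - c' • B) -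
          (ast K B C' - ast K C B'))
        (D B' - D' B + (-2 : ℝ) • (c • A' - a • C') + (2 : ℝ) • (c' • A - a' • C) -
          (ast K C A' - ast K A C'))
        (D C' - D' C + (2 : ℝ) • (a • B' - b • A') - (2 : ℝ) • (a' • B - b' • A) +
          (ast K A B' - ast K B A'))
        (-2 * (b * c' - c * b') - 1 / 3 * (trForm K B C' - trForm K C B'))
        (-2 * (c * a' - a * c') - 1 / 3 * (trForm K C A' - trForm K A C'))
        (2 * (a * b' - b * a') + 1 / 3 * (trForm K A B' - trForm K B A')) := by
  have fii : form (i : SplitQuaternion) i = -1 := by simp [form, coe_i]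
  have fij : form (i : SplitQuaternion) j = 0 := by simp [form, coe_i, coe_j]
  have fik : form (i : SplitQuaternion) k = 0 := by simp [form, coe_i, coe_k]
  have fji : form (j : SplitQuaternion) i = 0 := by simp [form, coe_i, coe_j]
  have fjj : form (j : SplitQuaternion) j = -1 := by simp [form, coe_j]
  have fjk : form (j : SplitQuaternion) k = 0 := by simp [form, coe_j, coe_k]
  have fki : form (k : SplitQuaternion) i = 0 := by simp [form, coe_k, coe_i]
  have fkj : form (k : SplitQuaternion) j = 0 := by simp [form, coe_k, coe_j]
  have fkk : form (k : SplitQuaternion) k = 1 := by simp [form, coe_k]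
  have hself (x : SplitQuaternion) : halfComm SplitQuaternion x x = 0 := by
    simp [CompositionAlgebra.halfComm_apply]
  have hij : halfComm SplitQuaternion i j = k := by
    rw [CompositionAlgebra.halfComm_apply]; ext <;> simp [coe_i, coe_j, coe_k]; norm_num
  have hji : halfComm SplitQuaternion j i = -k := by
    rw [CompositionAlgebra.halfComm_apply]; ext <;> simp [coe_i, coe_j, coe_k]; norm_num
  have hjk : halfComm SplitQuaternion j k = -i := by
    rw [CompositionAlgebra.halfComm_apply]; ext <;> simp [coe_i, coe_j, coe_k]; norm_num
  have hkj : halfComm SplitQuaternion k j = i := by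
    rw [CompositionAlgebra.halfComm_apply]; ext <;> simp [coe_i, coe_j, coe_k]; norm_num
  have hki : halfComm SplitQuaternion k i = -j := by
    rw [CompositionAlgebra.halfComm_apply]; ext <;> simp [coe_i, coe_j, coe_k]; norm_num
  have hik : halfComm SplitQuaternion i k = j := by
    rw [CompositionAlgebra.halfComm_apply]; ext <;> simp [coe_i, coe_j, coe_k]; norm_num
  unfold titsPoint
  rw [titsBracket_mk]
  refine congrArg₂ Prod.mk ?_ (congrArg₂ Prod.mk ?_ ?_)
  · simp only [map_add, LinearMap.add_apply, titsPart₁_tmul, fii, fij, fik, fji, fjj, fjk, fki,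
      fkj, fkk]
    module
  · simp only [map_add, LinearMap.add_apply, titsPart₂_tmul, hself, hij, hji, hjk, hkj, hki, hik,
      LinearMap.rTensor_tmul, LinearMap.lTensor_tmul, C_i, C_j, C_k, TensorProduct.tmul_add,
      TensorProduct.tmul_smul, TensorProduct.add_tmul, TensorProduct.sub_tmul,
      TensorProduct.tmul_neg, TensorProduct.tmul_zero, smul_sub, smul_smul]
    simp only [← TensorProduct.smul_tmul']
    module
  -- This factor 2 turns the `⅙` of the bracket into `⅓`.
  · have hd (x y : SplitQuaternion) : derMap SplitQuaternion x y = (2 : ℝ) •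
        (SplitQuaternion.C (halfComm SplitQuaternion x y) : Module.End ℝ SplitQuaternion) := by
      ext1 z
      rw [CompositionAlgebra.derMap_apply mul_assoc', LinearMap.smul_apply, C_apply,
        CompositionAlgebra.halfComm_apply, smul_mul_assoc, mul_smul_comm, ← smul_sub, smul_smul]
      norm_num
    simp only [map_add, LinearMap.add_apply, titsPart₃_tmul, hd, hself, hij, hji, hjk, hkj, hki,
      hik, C_lie]
    ext x <;> simp [C_apply, coe_i, coe_j, coe_k] <;> ring

end SplitQuaternionTits

/-! ### The isomorphism with the conformal algebra -/

section SplitQuaternionIso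

open SplitQuaternion

variable {K : Type*} [NonAssocRing K] [StarRing K] [Module ℝ K] [CompositionAlgebra K]
  [IsScalarTower ℝ K K] [SMulCommClass ℝ K K]

/-- The linear map underlying the isomorphism of `L₃(K, ℍ̃)` with the conformal algebra. -/
def titsMap : TitsSpace K SplitQuaternion →ₗ[ℝ] Module.End ℝ (H3 K) × H3 K × H3 K where
  -- For `E = C_q` with `q = ai + bj + ck`, the coefficients of the unit are `2a`, `b + c` and `b -
  -- c`. Reading them off `E i` and `E j` makes the map linear on the whole ambient space.
  toFun u := (u.1 + jmul K (contract coeffI u.2.1 + (u.2.2 j).imK • H3.unit K),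
    (1 / 2 : ℝ) • contract coeffJ u.2.1 + (1 / 2 : ℝ) • contract coeffK u.2.1 +
      (1 / 2 * (u.2.2 j).imI - 1 / 2 * (u.2.2 i).imK) • H3.unit K,
    (1 / 2 : ℝ) • contract coeffJ u.2.1 - (1 / 2 : ℝ) • contract coeffK u.2.1 +
      (-(1 / 2) * (u.2.2 j).imI - 1 / 2 * (u.2.2 i).imK) • H3.unit K)
  map_add' u v := by
    simp only [Prod.fst_add, Prod.snd_add, map_add, LinearMap.add_apply, QuaternionAlgebra.imI_add,
      QuaternionAlgebra.imK_add, Prod.mk_add_mk, map_smul]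
    refine congrArg₂ Prod.mk ?_ (congrArg₂ Prod.mk ?_ ?_) <;> module
  map_smul' r u := by
    simp only [Prod.smul_fst, Prod.smul_snd, map_smul, LinearMap.smul_apply, smul_eq_mul,
      QuaternionAlgebra.imI_smul, QuaternionAlgebra.imK_smul, Prod.smul_mk, map_add,
      RingHom.id_apply]
    refine congrArg₂ Prod.mk ?_ (congrArg₂ Prod.mk ?_ ?_) <;> module

theorem titsMap_titsPoint (D : Module.End ℝ (H3 K)) (A B C : H3 K) (a b c : ℝ) :
    titsMap (titsPoint D A B C a b c) = (D + jmul K (A + (2 * a) • H3.unit K),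
      (1 / 2 : ℝ) • B + (1 / 2 : ℝ) • C + (b + c) • H3.unit K,
      (1 / 2 : ℝ) • B - (1 / 2 : ℝ) • C + (b - c) • H3.unit K) := by
  have hc (f : SplitQuaternion →ₗ[ℝ] ℝ) : contract f (titsPoint D A B C a b c).2.1 =
      f i • A + f j • B + f k • C := by
    unfold titsPoint
    rw [map_add, map_add]
    rfl
  have h1 : contract coeffI (titsPoint D A B C a b c).2.1 = A :=
    (hc coeffI).trans (by simp [coe_i, coe_j, coe_k])
  have h2 : contract coeffJ (titsPoint D A B C a b c).2.1 = B :=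
    (hc coeffJ).trans (by simp [coe_i, coe_j, coe_k])
  have h3 : contract coeffK (titsPoint D A B C a b c).2.1 = C :=
    (hc coeffK).trans (by simp [coe_i, coe_j, coe_k])
  have hi : (titsPoint D A B C a b c).2.2 i = _ := C_i a b c
  have hj : (titsPoint D A B C a b c).2.2 j = _ := C_j a b c
  have e1 : ((titsPoint D A B C a b c).2.2 j).imK = 2 * a := by
    rw [hj]
    simp [coe_i, coe_k]
  have e2 : ((titsPoint D A B C a b c).2.2 j).imI = 2 * c := by
    rw [hj]
    simp [coe_i, coe_k]
  have e3 : ((titsPoint D A B C a b c).2.2 i).imK = -2 * b := by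
    rw [hi]
    simp [coe_j, coe_k]
  simp only [titsMap, LinearMap.coe_mk, AddHom.coe_mk, h1, h2, h3, e1, e2, e3]
  refine congrArg₂ Prod.mk rfl (congrArg₂ Prod.mk ?_ ?_) <;> module

variable [Nontrivial K]

theorem mem_str_of_der_le (h : ∀ D ∈ Der (jmul K), D ∈ Str (jmul K)) {D : Module.End ℝ (H3 K)}
    (hD : D ∈ Der (jmul K)) (A : H3 K) : D + jmul K A ∈ Str (jmul K) :=
  (Str _).add_mem (h D hD) (Str.mulLeft (jmul K) A).2

/-- The map of `L₃(K, ℍ̃)` to the conformal algebra. -/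
def titsToCon (h : ∀ D ∈ Der (jmul K), D ∈ Str (jmul K)) :
    L3 K SplitQuaternion →ₗ[ℝ] ConAlg (jmul K) where
  toFun u := (⟨(titsMap u).1, mem_str_of_der_le h u.2.1 _⟩, (titsMap u).2)
  map_add' u v := by
    have h := map_add titsMap (u : TitsSpace K SplitQuaternion) v
    exact Prod.ext (Subtype.ext (congrArg Prod.fst h)) (congrArg (fun x => x.2) h)
  map_smul' r u := by
    have h := map_smul titsMap r (u : TitsSpace K SplitQuaternion)
    exact Prod.ext (Subtype.ext (congrArg Prod.fst h)) (congrArg (fun x => x.2) h)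

theorem titsToCon_apply (h : ∀ D ∈ Der (jmul K), D ∈ Str (jmul K)) {u : L3 K SplitQuaternion}
    {D : Module.End ℝ (H3 K)} {A B C : H3 K} {a b c : ℝ}
    (hu : (u : TitsSpace K SplitQuaternion) = titsPoint D A B C a b c) :
    ((titsToCon h u).1 : Module.End ℝ (H3 K)) = D + jmul K (A + (2 * a) • H3.unit K) ∧
    (titsToCon h u).2.1 = (1 / 2 : ℝ) • B + (1 / 2 : ℝ) • C + (b + c) • H3.unit K ∧
    (titsToCon h u).2.2 = (1 / 2 : ℝ) • B - (1 / 2 : ℝ) • C + (b - c) • H3.unit K := by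
  have h1 := titsMap_titsPoint D A B C a b c
  rw [← hu] at h1
  exact ⟨congrArg Prod.fst h1, congrArg (fun x => x.2.1) h1, congrArg (fun x => x.2.2) h1⟩

theorem ast_eq_sub_unit (A B : H3 K) :
    ast K A B = jmul K A B - (2 / 3 * trForm K A B) • H3.unit K := by
  rw [ast_apply, H3.unit]
  module

/-- The multiple of the unit subtracted in `A ∗ B` cancels against the image of `⅙⟨A, B⟩ D_{x,y}`.
What is left needs only commutativity, the unit and the Leibniz rule, not the Jordan identity. -/
theorem titsToCon_lie (h : ∀ D ∈ Der (jmul K), D ∈ Str (jmul K)) (u v w : L3 K SplitQuaternion)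
    (hw : (w : TitsSpace K SplitQuaternion) = titsBracket K _ u v) :
    titsToCon h w = conBracket (jmul K) (H3.unit K) (titsToCon h u) (titsToCon h v) := by
  have J := H3.isUnitalJordan K
  obtain ⟨D, hD, A, -, B, -, C, -, a, b, c, hu⟩ := exists_eq_titsPoint u.2
  obtain ⟨D', hD', A', -, B', -, C', -, a', b', c', hv⟩ := exists_eq_titsPoint v.2
  rw [hu, hv, titsBracket_titsPoint] at hw
  obtain ⟨hu1, hu2, hu3⟩ := titsToCon_apply h hu
  obtain ⟨hv1, hv2, hv3⟩ := titsToCon_apply h hv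
  obtain ⟨hw1, hw2, hw3⟩ := titsToCon_apply h hw
  have hadd (S S' : Str (jmul K)) : ((S + S' : Str (jmul K)) : Module.End ℝ (H3 K)) = S + S' := rfl
  have hsub (S S' : Str (jmul K)) : ((S - S' : Str (jmul K)) : Module.End ℝ (H3 K)) = S - S' := rfl
  have hu4 := J.der_unit hD
  have hv4 := J.der_unit hD'
  refine Prod.ext (Subtype.ext ?_) (Prod.ext ?_ ?_)
  · simp only [conBracket, LinearMap.mk₂_apply, hadd, hsub, LieSubalgebra.coe_bracket,
      IsUnitalJordan.coe_box, hu1, hu2, hu3, hv1, hv2, hv3, hw1, ast_eq_sub_unit]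
    ext1 Z
    simp only [Ring.lie_def, LinearMap.add_apply, LinearMap.sub_apply, LinearMap.smul_apply,
      Module.End.mul_apply, map_add, map_sub, map_smul, J.unit_mul, J.mul_unit,
      Der.apply_mul hD, Der.apply_mul hD', J.comm B' B, J.comm C' B, J.comm C' C, J.comm B' C]
    module
  · simp only [conBracket, LinearMap.mk₂_apply, hu1, hu2, hv1, hv2, hw2, ast_eq_sub_unit]
    simp only [LinearMap.add_apply, LinearMap.smul_apply, map_add, map_smul, J.unit_mul, J.mul_unit, hu4,
      hv4, J.comm B A', J.comm C A']
    module
  · simp only [conBracket, LinearMap.mk₂_apply, IsUnitalJordan.coe_dagger, hu1, hu3, hv1, hv3, hw3,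
      ast_eq_sub_unit]
    simp only [LinearMap.add_apply, LinearMap.sub_apply, LinearMap.smul_apply, map_add, map_sub,
      map_smul, J.unit_mul, J.mul_unit, hu4, hv4, J.comm B A', J.comm C A', map_zero,
      LinearMap.zero_apply]
    module

theorem reTrace_unit : reTrace K (H3.unit K) = 3 / 2 := by
  rw [H3.unit, map_smul, H3.reTrace_idMatrix]
  norm_num

theorem eq_zero_of_add_smul_unit {A : H3 K} (hA : A ∈ H3' K) {r : ℝ}
    (h : A + r • H3.unit K = 0) : A = 0 ∧ r = 0 := by
  have h1 := congrArg (reTrace K) h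
  rw [H3.H3'_eq_ker, LinearMap.mem_ker] at hA
  rw [map_add, hA, map_smul, reTrace_unit, map_zero, zero_add, smul_eq_mul] at h1
  have hr : r = 0 := by linarith
  rw [hr, zero_smul, add_zero] at h
  exact ⟨h, hr⟩

theorem exists_eq_add_smul_unit (X : H3 K) : ∃ A ∈ H3' K, ∃ r : ℝ, X = A + r • H3.unit K := by
  refine ⟨X - (2 / 3 * reTrace K X) • H3.unit K, ?_, 2 / 3 * reTrace K X, by abel⟩
  rw [H3.H3'_eq_ker, LinearMap.mem_ker, map_sub, map_smul, reTrace_unit, smul_eq_mul]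
  ring

theorem der_add_mul_eq_zero {D : Module.End ℝ (H3 K)} (hD : D ∈ Der (jmul K)) {A : H3 K}
    (h : D + jmul K A = 0) : D = 0 ∧ A = 0 := by
  have h1 : A = 0 := by
    have := congrArg (fun S : Module.End ℝ (H3 K) => S (H3.unit K)) h
    simpa [(H3.isUnitalJordan K).der_unit hD, jmul_unit] using this
  rw [h1, map_zero, add_zero] at h
  exact ⟨h, h1⟩

theorem titsPoint_mem {D : Module.End ℝ (H3 K)} (hD : D ∈ Der (jmul K)) {A B C : H3 K}
    (hA : A ∈ H3' K) (hB : B ∈ H3' K) (hC : C ∈ H3' K) (a b c : ℝ) :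
    titsPoint D A B C a b c ∈ L3 K SplitQuaternion :=
  ⟨hD, Submodule.add_mem _ (Submodule.add_mem _ (Submodule.apply_mem_map₂ _ hA i.2)
    (Submodule.apply_mem_map₂ _ hB j.2)) (Submodule.apply_mem_map₂ _ hC k.2), Subtype.mem _⟩

theorem titsToCon_injective (h : ∀ D ∈ Der (jmul K), D ∈ Str (jmul K)) :
    Function.Injective (titsToCon h) := by
  rw [injective_iff_map_eq_zero]
  intro u h0
  obtain ⟨D, hD, A, hA, B, hB, C, hC, a, b, c, hu⟩ := exists_eq_titsPoint u.2
  obtain ⟨hu1, hu2, hu3⟩ := titsToCon_apply h hu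
  rw [h0] at hu1 hu2 hu3
  obtain ⟨h1, h2⟩ := der_add_mul_eq_zero hD hu1.symm
  obtain ⟨h3, h4⟩ := eq_zero_of_add_smul_unit hA h2
  have h5 : B + (2 * b) • H3.unit K = 0 := by
    change (0 : H3 K) = _ at hu2 hu3
    linear_combination (norm := module) -hu2 - hu3
  have h6 : C + (2 * c) • H3.unit K = 0 := by
    change (0 : H3 K) = _ at hu2 hu3
    linear_combination (norm := module) hu3 - hu2
  obtain ⟨h7, h8⟩ := eq_zero_of_add_smul_unit hB h5
  obtain ⟨h9, h10⟩ := eq_zero_of_add_smul_unit hC h6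
  apply Subtype.ext
  rw [hu, h1, h3, h7, h9, (by linarith : a = 0), (by linarith : b = 0), (by linarith : c = 0)]
  refine congrArg₂ Prod.mk rfl (congrArg₂ Prod.mk ?_ ?_)
  · simp
  · ext x <;> simp [C_apply]

theorem titsToCon_surjective (h : ∀ D ∈ Der (jmul K), D ∈ Str (jmul K)) :
    Function.Surjective (titsToCon h) := by
  rintro ⟨T, X, Y⟩
  obtain ⟨D, hD, hT⟩ := (H3.isUnitalJordan K).exists_of_mem_str T
  -- The preimage must satisfy `A + 2ae = T e`, `B + 2be = X + Y` and `C + 2ce = X - Y`, hence the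
  -- halved coefficients.
  obtain ⟨A, hA, a, hA'⟩ := exists_eq_add_smul_unit ((T : Module.End ℝ (H3 K)) (H3.unit K))
  obtain ⟨B, hB, b, hB'⟩ := exists_eq_add_smul_unit (X + Y)
  obtain ⟨C, hC, c, hC'⟩ := exists_eq_add_smul_unit (X - Y)
  refine ⟨⟨titsPoint D A B C (a / 2) (b / 2) (c / 2), titsPoint_mem hD hA hB hC _ _ _⟩, ?_⟩
  obtain ⟨h1, h2, h3⟩ := titsToCon_apply h (u := ⟨titsPoint D A B C (a / 2) (b / 2) (c / 2),
    titsPoint_mem hD hA hB hC _ _ _⟩) rfl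
  refine Prod.ext (Subtype.ext ?_) (Prod.ext ?_ ?_)
  · rw [h1, hT, hA', mul_div_cancel₀ _ two_ne_zero]
  · rw [h2]
    linear_combination (norm := module) (-1 / 2 : ℝ) • (hB' + hC')
  · rw [h3]
    linear_combination (norm := module) (-1 / 2 : ℝ) • (hB' - hC')

end SplitQuaternionIso

theorem SplitQuaternion.coe_C_zero :
    (SplitQuaternion.C ⟨0, 0, 0, 0⟩ : Module.End ℝ SplitQuaternion) = 0 := by
  ext x <;> simp [SplitQuaternion.C_apply]

/-! ### The isomorphism with the reduced structure algebra -/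

section SplitComplexIso

variable {K : Type*} [NonAssocRing K] [StarRing K] [Module ℝ K] [CompositionAlgebra K]
  [IsScalarTower ℝ K K] [SMulCommClass ℝ K K] [Nontrivial K]

theorem SplitComplex.mul_assoc' (x y z : SplitComplex) : x * y * z = x * (y * z) :=
  mul_assoc x y z

theorem SplitComplex.coe_i : (SplitComplex.i : SplitComplex) = ⟨0, 1⟩ := rfl

/-- The coefficient of `i`. -/
def SplitComplex.coeffI : SplitComplex →ₗ[ℝ] ℝ where
  toFun x := x.im
  map_add' _ _ := rfl
  map_smul' _ _ := rfl

theorem SplitComplex.eq_smul_i {x : SplitComplex} (hx : x ∈ Imag SplitComplex) :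
    x = x.im • (SplitComplex.i : SplitComplex) := by
  have h : x.re = 0 := by simpa [Imag, form] using hx
  ext <;> simp [coe_i, h]

/-- Here `0 = E(i²) = 2i E(i)`, and `i` is invertible. -/
theorem SplitComplex.der_eq_zero {E : Module.End ℝ SplitComplex}
    (hE : E ∈ Der (LinearMap.mul ℝ SplitComplex)) : E = 0 := by
  have h1 := der_one_eq_zero hE
  have h2 := hE SplitComplex.i SplitComplex.i
  have hii : (SplitComplex.i : SplitComplex) * SplitComplex.i = 1 := by ext <;> simp [coe_i]
  simp only [LinearMap.mul_apply', hii, h1] at h2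
  have h3 : E SplitComplex.i = 0 := by
    simp only [QuadraticAlgebra.ext_iff] at h2
    simp [coe_i] at h2
    ext <;> simp [coe_i] <;> linarith
  ext1 x
  have hx : x = x.re • (1 : SplitComplex) + x.im • (SplitComplex.i : SplitComplex) := by
    ext <;> simp [coe_i]
  rw [hx, map_add, map_smul, map_smul, h1, h3]
  simp

open SplitComplex in
theorem exists_eq_splitComplex {u : TitsSpace K SplitComplex} (hu : u ∈ L3 K SplitComplex) :
    ∃ D ∈ Der (jmul K), ∃ A ∈ H3' K, u = (D, A ⊗ₜ (SplitComplex.i : SplitComplex), 0) := by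
  obtain ⟨D, t, E⟩ := u
  obtain ⟨hD, ht, hE⟩ := hu
  refine ⟨D, hD, _, contract_mem coeffI ht,
    congrArg₂ Prod.mk rfl (congrArg₂ Prod.mk ?_ (der_eq_zero hE))⟩
  let P : H3 K ⊗[ℝ] SplitComplex →ₗ[ℝ] H3 K ⊗[ℝ] SplitComplex :=
    (TensorProduct.mk ℝ (H3 K) SplitComplex).flip (i : SplitComplex) ∘ₗ contract coeffI
  have hP : Submodule.map₂ (TensorProduct.mk ℝ (H3 K) SplitComplex) (H3' K)
      (Imag SplitComplex) ≤ LinearMap.eqLocus LinearMap.id P := by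
    refine Submodule.map₂_le.mpr fun A _ x hx => ?_
    change A ⊗ₜ x = (x.im • A) ⊗ₜ[ℝ] (i : SplitComplex)
    conv_lhs => rw [eq_smul_i hx]
    rw [TensorProduct.tmul_smul, TensorProduct.smul_tmul']
  exact hP ht

theorem titsBracket_splitComplex (D D' : Module.End ℝ (H3 K)) (A A' : H3 K) :
    titsBracket K SplitComplex (D, A ⊗ₜ (SplitComplex.i : SplitComplex), 0)
        (D', A' ⊗ₜ (SplitComplex.i : SplitComplex), 0) =
      (⁅D, D'⁆ + ⁅(jmul K A : Module.End ℝ (H3 K)), jmul K A'⁆,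
        (D A' - D' A) ⊗ₜ (SplitComplex.i : SplitComplex), 0) := by
  have fii : form (SplitComplex.i : SplitComplex) SplitComplex.i = -1 := by
    simp [form, SplitComplex.coe_i]
  have hii : halfComm SplitComplex SplitComplex.i SplitComplex.i = 0 := by
    simp [CompositionAlgebra.halfComm_apply]
  have dii : derMap SplitComplex SplitComplex.i SplitComplex.i = 0 := by
    ext1 z
    rw [CompositionAlgebra.derMap_apply SplitComplex.mul_assoc', sub_self, zero_mul, mul_zero,
      sub_zero, LinearMap.zero_apply]
  rw [titsBracket_mk]
  refine congrArg₂ Prod.mk ?_ (congrArg₂ Prod.mk ?_ ?_)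
  · rw [titsPart₁_tmul, fii, neg_neg, one_smul]
  · rw [titsPart₂_tmul, hii, TensorProduct.tmul_zero, TensorProduct.sub_tmul]
    simp
  · rw [titsPart₃_tmul, dii]
    simp

/-- The map of `L₃(K, ℂ̃)` to the structure algebra. -/
def titsToStr (h : ∀ D ∈ Der (jmul K), D ∈ Str (jmul K)) :
    L3 K SplitComplex →ₗ[ℝ] Str (jmul K) where
  toFun u := ⟨(u : TitsSpace K SplitComplex).1 +
    jmul K (contract SplitComplex.coeffI (u : TitsSpace K SplitComplex).2.1),
    mem_str_of_der_le h u.2.1 _⟩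
  map_add' u v := by
    apply Subtype.ext
    change (u : TitsSpace K SplitComplex).1 + (v : TitsSpace K SplitComplex).1 +
      jmul K (contract SplitComplex.coeffI ((u : TitsSpace K SplitComplex).2.1 +
        (v : TitsSpace K SplitComplex).2.1)) = (_ + _) + (_ + _)
    rw [map_add, map_add]
    abel
  map_smul' r u := by
    apply Subtype.ext
    change r • (u : TitsSpace K SplitComplex).1 +
      jmul K (contract SplitComplex.coeffI (r • (u : TitsSpace K SplitComplex).2.1)) = r • (_ + _)
    rw [map_smul, map_smul, smul_add]

theorem titsToStr_apply (h : ∀ D ∈ Der (jmul K), D ∈ Str (jmul K)) {u : L3 K SplitComplex}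
    {D : Module.End ℝ (H3 K)} {A : H3 K}
    (hu : (u : TitsSpace K SplitComplex) = (D, A ⊗ₜ (SplitComplex.i : SplitComplex), 0)) :
    (titsToStr h u : Module.End ℝ (H3 K)) = D + jmul K A := by
  have h1 : contract SplitComplex.coeffI (A ⊗ₜ[ℝ] (SplitComplex.i : SplitComplex)) = A :=
    one_smul ℝ A
  change (u : TitsSpace K SplitComplex).1 +
    jmul K (contract SplitComplex.coeffI (u : TitsSpace K SplitComplex).2.1) = _
  rw [hu, h1]

theorem titsToStr_lie (h : ∀ D ∈ Der (jmul K), D ∈ Str (jmul K)) (u v w : L3 K SplitComplex)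
    (hw : (w : TitsSpace K SplitComplex) = titsBracket K _ u v) :
    titsToStr h w = ⁅titsToStr h u, titsToStr h v⁆ := by
  obtain ⟨D, hD, A, -, hu⟩ := exists_eq_splitComplex u.2
  obtain ⟨D', hD', A', -, hv⟩ := exists_eq_splitComplex v.2
  rw [hu, hv, titsBracket_splitComplex] at hw
  apply Subtype.ext
  rw [LieSubalgebra.coe_bracket, titsToStr_apply h hu, titsToStr_apply h hv, titsToStr_apply h hw,
    map_sub, ← Der.lie_mul hD, ← Der.lie_mul hD', lie_add, add_lie, add_lie,
    ← lie_skew (jmul K A) D']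
  abel

theorem titsToStr_injective (h : ∀ D ∈ Der (jmul K), D ∈ Str (jmul K)) :
    Function.Injective (titsToStr h) := by
  rw [injective_iff_map_eq_zero]
  intro u h0
  obtain ⟨D, hD, A, -, hu⟩ := exists_eq_splitComplex u.2
  have h1 := titsToStr_apply h hu
  rw [h0] at h1
  obtain ⟨h2, h3⟩ := der_add_mul_eq_zero hD h1.symm
  apply Subtype.ext
  rw [hu, h2, h3, TensorProduct.zero_tmul]
  rfl

/-- The map of `L₃(K, ℂ̃)` to the reduced structure algebra. -/
def titsToStrPrime (h : ∀ D ∈ Der (jmul K), D ∈ Str (jmul K)) :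
    L3 K SplitComplex →ₗ[ℝ] StrPrime (jmul K) :=
  (LieSubmodule.Quotient.mk' (LieAlgebra.center ℝ (Str (jmul K)))).toLinearMap ∘ₗ titsToStr h

theorem titsToStrPrime_apply (h : ∀ D ∈ Der (jmul K), D ∈ Str (jmul K)) (u : L3 K SplitComplex) :
    titsToStrPrime h u = LieSubmodule.Quotient.mk (titsToStr h u) := rfl

/-- The image in `Str` is `Der + L(H₃')`, while the centre is `ℝ·id = ℝ·L_e`; they are complementary
because `H₃ = H₃' ⊕ ℝe`. -/
theorem titsToStrPrime_bijective [FiniteDimensional ℝ K] (hpos : ∀ x : K, x ≠ 0 → 0 < form x x)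
    (h : ∀ D ∈ Der (jmul K), D ∈ Str (jmul K)) : Function.Bijective (titsToStrPrime h) := by
  have J := H3.isUnitalJordan K
  constructor
  · rw [injective_iff_map_eq_zero]
    intro u h0
    obtain ⟨D, hD, A, hA, hu⟩ := exists_eq_splitComplex u.2
    rw [titsToStrPrime_apply, LieSubmodule.Quotient.mk_eq_zero', H3.mem_center_str hpos] at h0
    obtain ⟨r, hr⟩ := h0
    rw [titsToStr_apply h hu] at hr
    have h1 := congrArg (fun S : Module.End ℝ (H3 K) => S (H3.unit K)) hr
    have h2 : A + (-r) • H3.unit K = 0 := by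
      simp only [LinearMap.add_apply, J.der_unit hD, J.mul_unit, LinearMap.smul_apply,
        Module.End.one_apply, zero_add] at h1
      rw [h1]
      module
    obtain ⟨h3, h4⟩ := eq_zero_of_add_smul_unit hA h2
    rw [h3, neg_eq_zero.mp h4, map_zero, add_zero, zero_smul] at hr
    apply Subtype.ext
    rw [hu, h3, hr, TensorProduct.zero_tmul]
    rfl
  · intro q
    obtain ⟨T, rfl⟩ := LieSubmodule.Quotient.surjective_mk' _ q
    obtain ⟨D, hD, hT⟩ := J.exists_of_mem_str T
    obtain ⟨A, hA, a, hA'⟩ := exists_eq_add_smul_unit ((T : Module.End ℝ (H3 K)) (H3.unit K))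
    have hm : (D, A ⊗ₜ (SplitComplex.i : SplitComplex), 0) ∈ L3 K SplitComplex :=
      ⟨hD, Submodule.apply_mem_map₂ _ hA SplitComplex.i.2, (Der _).zero_mem⟩
    refine ⟨⟨_, hm⟩, ?_⟩
    have h1 := titsToStr_apply h (u := ⟨_, hm⟩) rfl
    rw [titsToStrPrime_apply, ← sub_eq_zero]
    refine (LieSubmodule.Quotient.mk_eq_zero' (N := LieAlgebra.center ℝ (Str (jmul K)))
      (m := titsToStr h ⟨_, hm⟩ - T)).mpr ?_
    rw [H3.mem_center_str hpos]
    refine ⟨-a, ?_⟩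
    change (titsToStr h ⟨_, hm⟩ : Module.End ℝ (H3 K)) - T = _
    rw [h1, hT, hA', map_add, map_smul]
    have h2 : jmul K (H3.unit K) = (1 : Module.End ℝ (H3 K)) :=
      LinearMap.ext fun B => J.unit_mul B
    rw [h2]
    module

end SplitComplexIso

/-! ### The isomorphism with the derivation algebra -/

section RealIso

variable {K : Type*} [NonAssocRing K] [StarRing K] [Module ℝ K] [CompositionAlgebra K]
  [IsScalarTower ℝ K K] [SMulCommClass ℝ K K]

theorem eq_zero_of_mem_der_real {E : Module.End ℝ ℝ} (hE : E ∈ Der (LinearMap.mul ℝ ℝ)) :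
    E = 0 :=
  LinearMap.ext_ring (der_one_eq_zero hE)

theorem eq_zero_of_mem_imag_real {x : ℝ} (hx : x ∈ Imag ℝ) : x = 0 := by
  simpa [Imag, form] using hx

theorem exists_eq_real {u : TitsSpace K ℝ} (hu : u ∈ L3 K ℝ) :
    ∃ D ∈ Der (jmul K), u = (D, 0, 0) := by
  obtain ⟨D, t, E⟩ := u
  obtain ⟨hD, ht, hE⟩ := hu
  refine ⟨D, hD, congrArg₂ Prod.mk rfl (congrArg₂ Prod.mk ?_ (eq_zero_of_mem_der_real hE))⟩
  have h : Submodule.map₂ (TensorProduct.mk ℝ (H3 K) ℝ) (H3' K) (Imag ℝ) ≤ ⊥ := by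
    refine Submodule.map₂_le.mpr fun A _ x hx => ?_
    rw [eq_zero_of_mem_imag_real hx, map_zero]
    exact Submodule.zero_mem _
  exact h ht

/-- The map of `L₃(K, ℝ)` to the derivation algebra. -/
def titsToDer : L3 K ℝ →ₗ[ℝ] Der (jmul K) where
  toFun u := ⟨(u : TitsSpace K ℝ).1, u.2.1⟩
  map_add' _ _ := rfl
  map_smul' _ _ := rfl

theorem titsToDer_lie (u v w : L3 K ℝ) (hw : (w : TitsSpace K ℝ) = titsBracket K _ u v) :
    titsToDer w = ⁅titsToDer u, titsToDer v⁆ := by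
  obtain ⟨D, -, hu⟩ := exists_eq_real u.2
  obtain ⟨D', -, hv⟩ := exists_eq_real v.2
  apply Subtype.ext
  change (w : TitsSpace K ℝ).1 = ⁅(u : TitsSpace K ℝ).1, (v : TitsSpace K ℝ).1⁆
  rw [hw, hu, hv]
  change ⁅D, D'⁆ + titsPart₁ K ℝ 0 0 = _
  rw [map_zero, add_zero]

theorem titsToDer_bijective : Function.Bijective (titsToDer (K := K)) := by
  constructor
  · rw [injective_iff_map_eq_zero]
    intro u h0
    obtain ⟨D, -, hu⟩ := exists_eq_real u.2
    have h1 : (u : TitsSpace K ℝ).1 = 0 := congrArg Subtype.val h0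
    apply Subtype.ext
    rw [hu] at h1 ⊢
    exact congrArg₂ Prod.mk h1 rfl
  · exact fun D => ⟨L3.ofDer D, rfl⟩

end RealIso

/-! ### Finite dimension and positivity for `ℝ`, `ℂ`, `ℍ`, `𝕆` -/

namespace IsRCHO

variable {K : Type} [NonAssocRing K] [StarRing K] [Module ℝ K] [IsScalarTower ℝ K K]
    [SMulCommClass ℝ K K] [CompositionAlgebra K]

theorem nontrivial (hK : IsRCHO K) : Nontrivial K := by
  cases hK
  · infer_instance
  · infer_instance
  · infer_instance
  · exact ⟨0, 1, fun h => zero_ne_one (congrArg Octonion.fst h)⟩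

theorem finiteDimensional (hK : IsRCHO K) : FiniteDimensional ℝ K := by
  cases hK
  · infer_instance
  · infer_instance
  · infer_instance
  · let f : Octonion →ₗ[ℝ] ℍ[ℝ] × ℍ[ℝ] :=
      { toFun := fun x => (x.fst, x.snd)
        map_add' := fun _ _ => rfl
        map_smul' := fun _ _ => rfl }
    exact FiniteDimensional.of_injective f fun x y h =>
      Octonion.ext (congrArg Prod.fst h) (congrArg Prod.snd h)

theorem quaternion_form_self (x : ℍ[ℝ]) : form x x = Quaternion.normSq x := by
  rw [Quaternion.normSq_def']
  simp [form]
  ring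

/-- Positivity passes to the trace form on `H₃(K)`, where it yields inner derivations and the centre
of `Str`. -/
theorem form_self_pos (hK : IsRCHO K) : ∀ x : K, x ≠ 0 → 0 < form x x := by
  have hq (x : ℍ[ℝ]) (hx : x ≠ 0) : 0 < form x x := by
    rw [quaternion_form_self]
    exact lt_of_le_of_ne Quaternion.normSq_nonneg fun h => hx (Quaternion.normSq_eq_zero.mp h.symm)
  have hq' (x : ℍ[ℝ]) : 0 ≤ form x x := by
    rw [quaternion_form_self]
    exact Quaternion.normSq_nonneg
  cases hK
  · exact fun x hx => mul_self_pos.mpr hx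
  · intro x hx
    have h : form x x = Complex.normSq x := (Complex.normSq_apply x).symm
    rw [h]
    exact Complex.normSq_pos.mpr hx
  · exact hq
  · intro x hx
    change 0 < form x.fst x.fst + form x.snd x.snd
    by_cases h : x.fst = 0
    · refine add_pos_of_nonneg_of_pos (hq' _) (hq _ fun h' => hx (Octonion.ext h h'))
    · exact add_pos_of_pos_of_nonneg (hq _ h) (hq' _)

end IsRCHO

end

/-! ### The main theorem -/

theorem theorem7 (K : Type) [NonAssocRing K] [StarRing K] [Module ℝ K] [IsScalarTower ℝ K K]
    [SMulCommClass ℝ K K] [CompositionAlgebra K] (hK : IsRCHO K) :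
    -- the brackets are well defined and are Lie brackets
    IsLieOn (titsBracket K ℝ) (L3 K ℝ) ∧
    IsLieOn (titsBracket K SplitComplex) (L3 K SplitComplex) ∧
    IsLieOn (titsBracket K SplitQuaternion) (L3 K SplitQuaternion) ∧
    IsLieOn (conBracket (jmul K) (H3.unit K)) ⊤ ∧
    ∃ (φ : L3 K SplitQuaternion ≃ₗ[ℝ] ConAlg (jmul K))
      (φ₁ : L3 K SplitComplex ≃ₗ[ℝ] StrPrime (jmul K))
      (φ₂ : L3 K ℝ ≃ₗ[ℝ] Der (jmul K)),
      -- the three maps are isomorphisms of Lie algebras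
      (∀ u v w : L3 K SplitQuaternion, (w : TitsSpace K SplitQuaternion) = titsBracket K _ u v →
        φ w = conBracket (jmul K) (H3.unit K) (φ u) (φ v)) ∧
      (∀ u v w : L3 K SplitComplex, (w : TitsSpace K SplitComplex) = titsBracket K _ u v →
        φ₁ w = ⁅φ₁ u, φ₁ v⁆) ∧
      (∀ u v w : L3 K ℝ, (w : TitsSpace K ℝ) = titsBracket K _ u v →
        φ₂ w = ⁅φ₂ u, φ₂ v⁆) ∧
      -- explicit description of `φ`, with `φ₁` and `φ₂` as its restrictions
      (∀ D : Der (jmul K), ∃ s : Str (jmul K), (s : Module.End ℝ (H3 K)) = D ∧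
        φ (L3.ofDer D) = (s, 0, 0) ∧
        φ₁ (L3.ofDer D) = LieSubmodule.Quotient.mk s ∧
        φ₂ (L3.ofDer D) = D) ∧
      (∀ B : H3' K, φ (L3.tmul B SplitQuaternion.i) = (Str.mulLeft (jmul K) B, 0, 0) ∧
        φ₁ (L3.tmul B SplitComplex.i) =
          LieSubmodule.Quotient.mk (Str.mulLeft (jmul K) (B : H3 K))) ∧
      (∀ B : H3' K, φ (L3.tmul B SplitQuaternion.j) =
        (0, (1 / 2 : ℝ) • (B : H3 K), (1 / 2 : ℝ) • (B : H3 K))) ∧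
      (∀ B : H3' K, φ (L3.tmul B SplitQuaternion.k) =
        (0, (1 / 2 : ℝ) • (B : H3 K), -((1 / 2 : ℝ) • (B : H3 K)))) ∧
      φ (L3.ofDer₂ (SplitQuaternion.C SplitQuaternion.i)) =
        ((2 : ℝ) • Str.mulLeft (jmul K) (H3.unit K), 0, 0) ∧
      φ (L3.ofDer₂ (SplitQuaternion.C SplitQuaternion.j)) = (0, H3.unit K, H3.unit K) ∧
      φ (L3.ofDer₂ (SplitQuaternion.C SplitQuaternion.k)) = (0, H3.unit K, -H3.unit K) := by
  have : Nontrivial K := hK.nontrivial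
  have : FiniteDimensional ℝ K := hK.finiteDimensional
  have hpos := hK.form_self_pos
  have h : ∀ D ∈ Der (jmul K), D ∈ Str (jmul K) := fun D hD => H3.der_le_str hpos hD
  have hcon := (H3.isUnitalJordan K).conBracket_isLieOn
  refine ⟨?_, ?_, ?_, hcon, LinearEquiv.ofBijective (titsToCon h)
      ⟨titsToCon_injective h, titsToCon_surjective h⟩,
    LinearEquiv.ofBijective (titsToStrPrime h) (titsToStrPrime_bijective hpos h),
    LinearEquiv.ofBijective titsToDer titsToDer_bijective,
    titsToCon_lie h, ?_, titsToDer_lie, ?_, ?_, ?_, ?_, ?_, ?_, ?_⟩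
  · refine isLieOn_of_injective (isLieOn_lieBilin (Der (jmul K)))
      (titsBracket_mem mul_assoc fun E hE x _ => ?_) titsToDer titsToDer_bijective.1 titsToDer_lie
    rw [eq_zero_of_mem_der_real hE]
    exact Submodule.zero_mem _
  -- The map to `Str` is already injective and respects brackets, so the quotient by the centre
  -- plays no role here.
  · refine isLieOn_of_injective (isLieOn_lieBilin (Str (jmul K)))
      (titsBracket_mem SplitComplex.mul_assoc' fun E hE x _ => ?_) (titsToStr h)
      (titsToStr_injective h) (titsToStr_lie h)
    rw [SplitComplex.der_eq_zero hE]
    exact Submodule.zero_mem _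
  · exact isLieOn_of_injective hcon
      (titsBracket_mem SplitQuaternion.mul_assoc' fun E hE x _ => SplitQuaternion.der_mem_imag hE x)
      (titsToCon h) (titsToCon_injective h) (titsToCon_lie h)
  · intro u v w hw
    have := titsToStr_lie h u v w hw
    change titsToStrPrime h w = ⁅titsToStrPrime h u, titsToStrPrime h v⁆
    rw [titsToStrPrime_apply, this]
    rfl
  · intro D
    refine ⟨⟨D, h D D.2⟩, rfl, ?_, ?_, rfl⟩
    · have hu : (L3.ofDer D : L3 K SplitQuaternion).1 = titsPoint D 0 0 0 0 0 0 :=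
        congrArg₂ Prod.mk rfl (congrArg₂ Prod.mk (by simp) SplitQuaternion.coe_C_zero.symm)
      obtain ⟨h1, h2, h3⟩ := titsToCon_apply h hu
      exact Prod.ext (Subtype.ext (h1.trans (by simp))) (Prod.ext (h2.trans (by simp))
        (h3.trans (by simp)))
    · have hu : (L3.ofDer D : L3 K SplitComplex).1 =
          ((D : Module.End ℝ (H3 K)), 0 ⊗ₜ (SplitComplex.i : SplitComplex), 0) :=
        congrArg₂ Prod.mk rfl (congrArg₂ Prod.mk (TensorProduct.zero_tmul _ _).symm rfl)
      exact congrArg LieSubmodule.Quotient.mk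
        (Subtype.ext ((titsToStr_apply h hu).trans (by simp)))
  · intro B
    constructor
    · have hu : (L3.tmul B SplitQuaternion.i : L3 K SplitQuaternion).1 =
          titsPoint 0 B 0 0 0 0 0 :=
        congrArg₂ Prod.mk rfl (congrArg₂ Prod.mk (by simp) SplitQuaternion.coe_C_zero.symm)
      obtain ⟨h1, h2, h3⟩ := titsToCon_apply h hu
      exact Prod.ext (Subtype.ext (h1.trans (by simp [Str.mulLeft])))
        (Prod.ext (h2.trans (by simp)) (h3.trans (by simp)))
    · have hu : (L3.tmul B SplitComplex.i : L3 K SplitComplex).1 =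
          (0, (B : H3 K) ⊗ₜ (SplitComplex.i : SplitComplex), 0) := rfl
      exact congrArg LieSubmodule.Quotient.mk
        (Subtype.ext ((titsToStr_apply h hu).trans (zero_add _)))
  · intro B
    have hu : (L3.tmul B SplitQuaternion.j : L3 K SplitQuaternion).1 =
        titsPoint 0 0 B 0 0 0 0 :=
      congrArg₂ Prod.mk rfl (congrArg₂ Prod.mk (by simp) SplitQuaternion.coe_C_zero.symm)
    obtain ⟨h1, h2, h3⟩ := titsToCon_apply h hu
    exact Prod.ext (Subtype.ext (h1.trans (by simp))) (Prod.ext (h2.trans (by simp))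
      (h3.trans (by simp)))
  · intro B
    have hu : (L3.tmul B SplitQuaternion.k : L3 K SplitQuaternion).1 =
        titsPoint 0 0 0 B 0 0 0 :=
      congrArg₂ Prod.mk rfl (congrArg₂ Prod.mk (by simp) SplitQuaternion.coe_C_zero.symm)
    obtain ⟨h1, h2, h3⟩ := titsToCon_apply h hu
    exact Prod.ext (Subtype.ext (h1.trans (by simp))) (Prod.ext (h2.trans (by simp))
      (h3.trans (by simp)))
  · have hu : (L3.ofDer₂ (SplitQuaternion.C SplitQuaternion.i) : L3 K SplitQuaternion).1 =
        titsPoint 0 0 0 0 1 0 0 :=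
      congrArg₂ Prod.mk rfl (congrArg₂ Prod.mk (by simp) rfl)
    obtain ⟨h1, h2, h3⟩ := titsToCon_apply h hu
    exact Prod.ext (Subtype.ext (h1.trans (by simp [Str.mulLeft])))
      (Prod.ext (h2.trans (by simp)) (h3.trans (by simp)))
  · have hu : (L3.ofDer₂ (SplitQuaternion.C SplitQuaternion.j) : L3 K SplitQuaternion).1 =
        titsPoint 0 0 0 0 0 1 0 :=
      congrArg₂ Prod.mk rfl (congrArg₂ Prod.mk (by simp) rfl)
    obtain ⟨h1, h2, h3⟩ := titsToCon_apply h hu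
    exact Prod.ext (Subtype.ext (h1.trans (by simp))) (Prod.ext (h2.trans (by simp))
      (h3.trans (by simp)))
  · have hu : (L3.ofDer₂ (SplitQuaternion.C SplitQuaternion.k) : L3 K SplitQuaternion).1 =
        titsPoint 0 0 0 0 0 0 1 :=
      congrArg₂ Prod.mk rfl (congrArg₂ Prod.mk (by simp) rfl)
    obtain ⟨h1, h2, h3⟩ := titsToCon_apply h hu
    exact Prod.ext (Subtype.ext (h1.trans (by simp))) (Prod.ext (h2.trans (by simp))
      (h3.trans (by simp)))
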